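/- Let $n \ge 1$ and let $\Omega \subset \mathbb{R}^n$ be a bounded domain (a nonempty connected bounded open set). Consider the clamped plate problem $$\Delta^2 w = \Gamma w \ \text{ in } \Omega, \qquad w = 0 = \frac{\partial w}{\partial n} \ \text{ on } \partial\Omega,$$ for real $w$, understood in the weak sense: $w$ belongs to $H^2_0(\Omega)$, the closure of $C_c^\infty(\Omega)$ in the Sobolev space $H^2(\Omega)$, and $\Delta^2 w = \Gamma w$ holds in $\Omega$ in the sense of distributions, that is, $\int_\Omega w\, \Delta^2\varphi = \Gamma \int_\Omega w\,\varphi$ for all $\varphi \in C_c^\infty(\Omega)$. The eigenvalues of this problem can be listed, each repeated according to its multiplicity, as an infinite sequence $$0 < \Gamma_1 \le \Gamma_2 \le \Gamma_3 \le \dots,$$ and they satisfy $$\frac{\Gamma_2^{1/2} + \Gamma_3^{1/2} + \dots + \Gamma_{n+1}^{1/2}}{\Gamma_1^{1/2}} \le n + 4 .$$ -/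

import Mathlib

open MeasureTheory TopologicalSpace Filter Topology
open scoped Distributions LineDeriv ENNReal

noncomputable section

namespace ClampedPlate

variable {n : ℕ}

/-- The real Hilbert space `L²(Ω)` of an open set `Ω ⊆ ℝⁿ`, with Lebesgue measure. -/
abbrev L2 (Ω : Opens (EuclideanSpace ℝ (Fin n))) : Type :=
  Lp ℝ 2 (volume.restrict (Ω : Set (EuclideanSpace ℝ (Fin n))))

/-- The partial derivative `∂φ/∂xᵢ` of a test function `φ ∈ C_c^∞(Ω)`. -/
def pd {Ω : Opens (EuclideanSpace ℝ (Fin n))} (i : Fin n) (φ : 𝓓(Ω, ℝ)) : 𝓓(Ω, ℝ) :=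
  ∂_{(EuclideanSpace.single i (1 : ℝ) : EuclideanSpace ℝ (Fin n))} φ

/-- The Laplacian `Δφ = ∑ᵢ ∂²φ/∂xᵢ²` of a test function. -/
def lap {Ω : Opens (EuclideanSpace ℝ (Fin n))} (φ : 𝓓(Ω, ℝ)) : 𝓓(Ω, ℝ) :=
  ∑ i, pd i (pd i φ)

/-- `g ∈ L²(Ω)` is the weak partial derivative `∂u/∂xᵢ` of `u ∈ L²(Ω)`. -/
def IsWeakPartial (Ω : Opens (EuclideanSpace ℝ (Fin n))) (i : Fin n) (u g : L2 Ω) : Prop :=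
  ∀ φ : 𝓓(Ω, ℝ),
    ∫ x in (Ω : Set (EuclideanSpace ℝ (Fin n))), u x * pd i φ x
      = -∫ x in (Ω : Set (EuclideanSpace ℝ (Fin n))), g x * φ x

/-- `φ k → u` in the norm of `L²(Ω)`. -/
def TendstoL2 (Ω : Opens (EuclideanSpace ℝ (Fin n))) (φ : ℕ → 𝓓(Ω, ℝ)) (u : L2 Ω) : Prop :=
  Tendsto (fun k => eLpNorm (fun x => φ k x - u x) 2
    (volume.restrict (Ω : Set (EuclideanSpace ℝ (Fin n))))) atTop (𝓝 0)

/-- `u ∈ H²₀(Ω)`: the function `u` has weak partial derivatives `g i` and `h i j` of first and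
second order in `L²(Ω)`, and is the limit, in the norm of the Sobolev space `H²(Ω)`, of a sequence
of functions in `C_c^∞(Ω)`. -/
def MemH20 (Ω : Opens (EuclideanSpace ℝ (Fin n))) (u : L2 Ω) : Prop :=
  ∃ (g : Fin n → L2 Ω) (h : Fin n → Fin n → L2 Ω),
    (∀ i, IsWeakPartial Ω i u (g i)) ∧
    (∀ i j, IsWeakPartial Ω j (g i) (h i j)) ∧
    ∃ φ : ℕ → 𝓓(Ω, ℝ),
      TendstoL2 Ω φ u ∧
      (∀ i, TendstoL2 Ω (fun k => pd i (φ k)) (g i)) ∧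
      (∀ i j, TendstoL2 Ω (fun k => pd j (pd i (φ k))) (h i j))

/-- `w ∈ L²(Ω)` satisfies `Δ²w = Γ w` in `Ω` in the sense of distributions. -/
def SolvesPlateEquation (Ω : Opens (EuclideanSpace ℝ (Fin n))) (Γ : ℝ) (w : L2 Ω) : Prop :=
  ∀ φ : 𝓓(Ω, ℝ),
    ∫ x in (Ω : Set (EuclideanSpace ℝ (Fin n))), w x * lap (lap φ) x
      = Γ * ∫ x in (Ω : Set (EuclideanSpace ℝ (Fin n))), w x * φ x

section Linearity

variable {Ω : Opens (EuclideanSpace ℝ (Fin n))}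

lemma pd_add (i : Fin n) (φ ψ : 𝓓(Ω, ℝ)) : pd i (φ + ψ) = pd i φ + pd i ψ :=
  LineDeriv.lineDerivOp_add _ _ _

lemma pd_smul (i : Fin n) (c : ℝ) (φ : 𝓓(Ω, ℝ)) : pd i (c • φ) = c • pd i φ :=
  LineDeriv.lineDerivOp_smul _ _ _

lemma pd_zero (i : Fin n) : pd i (0 : 𝓓(Ω, ℝ)) = 0 := by
  simpa using pd_smul i 0 (0 : 𝓓(Ω, ℝ))

lemma memLp_testFunction (φ : 𝓓(Ω, ℝ)) :
    MemLp φ 2 (volume.restrict (Ω : Set (EuclideanSpace ℝ (Fin n)))) :=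
  (φ.continuous.memLp_of_hasCompactSupport φ.hasCompactSupport (μ := volume)).restrict _

lemma integrable_mul_testFunction (u : L2 Ω) (φ : 𝓓(Ω, ℝ)) :
    Integrable (fun x => u x * φ x) (volume.restrict (Ω : Set (EuclideanSpace ℝ (Fin n)))) :=
  (Lp.memLp u).integrable_mul (memLp_testFunction φ)

lemma integral_add_mul (u v : L2 Ω) (φ : 𝓓(Ω, ℝ)) :
    ∫ x in (Ω : Set (EuclideanSpace ℝ (Fin n))), (u + v : L2 Ω) x * φ x
      = (∫ x in (Ω : Set (EuclideanSpace ℝ (Fin n))), u x * φ x)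
        + ∫ x in (Ω : Set (EuclideanSpace ℝ (Fin n))), v x * φ x := by
  rw [← integral_add (integrable_mul_testFunction u φ) (integrable_mul_testFunction v φ)]
  refine integral_congr_ae ?_
  filter_upwards [Lp.coeFn_add u v] with x hx
  rw [hx, Pi.add_apply, add_mul]

lemma integral_smul_mul (c : ℝ) (u : L2 Ω) (φ : 𝓓(Ω, ℝ)) :
    ∫ x in (Ω : Set (EuclideanSpace ℝ (Fin n))), (c • u : L2 Ω) x * φ x
      = c * ∫ x in (Ω : Set (EuclideanSpace ℝ (Fin n))), u x * φ x := by
  rw [← integral_const_mul]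
  refine integral_congr_ae ?_
  filter_upwards [Lp.coeFn_smul c u] with x hx
  rw [hx, Pi.smul_apply, smul_eq_mul, mul_assoc]

lemma IsWeakPartial.add {i : Fin n} {u v g h : L2 Ω} (hu : IsWeakPartial Ω i u g)
    (hv : IsWeakPartial Ω i v h) : IsWeakPartial Ω i (u + v) (g + h) := by
  intro φ
  rw [integral_add_mul, integral_add_mul, hu φ, hv φ]
  ring

lemma IsWeakPartial.smul {i : Fin n} {u g : L2 Ω} (c : ℝ) (hu : IsWeakPartial Ω i u g) :
    IsWeakPartial Ω i (c • u) (c • g) := by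
  intro φ
  rw [integral_smul_mul, integral_smul_mul, hu φ]
  ring

lemma TendstoL2.add {φ ψ : ℕ → 𝓓(Ω, ℝ)} {u v : L2 Ω} (hu : TendstoL2 Ω φ u)
    (hv : TendstoL2 Ω ψ v) : TendstoL2 Ω (fun k => φ k + ψ k) (u + v) := by
  have h0 := Tendsto.add hu hv
  rw [add_zero] at h0
  refine tendsto_of_tendsto_of_tendsto_of_le_of_le tendsto_const_nhds h0
    (fun _ => zero_le) (fun k => ?_)
  refine le_trans (le_of_eq ?_) (eLpNorm_add_le
    ((memLp_testFunction (φ k)).sub (Lp.memLp u)).aestronglyMeasurable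
    ((memLp_testFunction (ψ k)).sub (Lp.memLp v)).aestronglyMeasurable (by norm_num))
  refine eLpNorm_congr_ae ?_
  filter_upwards [Lp.coeFn_add u v] with x hx
  simp only [hx, Pi.add_apply]
  change φ k x + ψ k x - _ = _
  ring

lemma TendstoL2.smul {φ : ℕ → 𝓓(Ω, ℝ)} {u : L2 Ω} (c : ℝ) (hu : TendstoL2 Ω φ u) :
    TendstoL2 Ω (fun k => c • φ k) (c • u) := by
  have h0 := ENNReal.Tendsto.const_mul (a := ‖c‖ₑ) hu (Or.inr enorm_ne_top)
  rw [mul_zero] at h0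
  refine h0.congr (fun k => ?_)
  rw [← eLpNorm_const_smul]
  refine eLpNorm_congr_ae ?_
  filter_upwards [Lp.coeFn_smul c u] with x hx
  simp only [hx, Pi.smul_apply, smul_eq_mul]
  change _ = c * φ k x - _
  ring

lemma MemH20.add {u v : L2 Ω} (hu : MemH20 Ω u) (hv : MemH20 Ω v) : MemH20 Ω (u + v) := by
  obtain ⟨g, h, hg, hh, φ, h0, h1, h2⟩ := hu
  obtain ⟨g', h', hg', hh', φ', h0', h1', h2'⟩ := hv
  refine ⟨g + g', h + h', fun i => (hg i).add (hg' i), fun i j => (hh i j).add (hh' i j),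
    fun k => φ k + φ' k, h0.add h0', fun i => ?_, fun i j => ?_⟩
  · simpa only [pd_add, Pi.add_apply] using (h1 i).add (h1' i)
  · simpa only [pd_add, Pi.add_apply] using (h2 i j).add (h2' i j)

lemma MemH20.smul {u : L2 Ω} (c : ℝ) (hu : MemH20 Ω u) : MemH20 Ω (c • u) := by
  obtain ⟨g, h, hg, hh, φ, h0, h1, h2⟩ := hu
  refine ⟨c • g, c • h, fun i => (hg i).smul c, fun i j => (hh i j).smul c,
    fun k => c • φ k, h0.smul c, fun i => ?_, fun i j => ?_⟩
  · simpa only [pd_smul, Pi.smul_apply] using (h1 i).smul c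
  · simpa only [pd_smul, Pi.smul_apply] using (h2 i j).smul c

lemma tendstoL2_zero : TendstoL2 Ω (fun _ => 0) 0 := by
  refine tendsto_const_nhds.congr (fun _ => ?_)
  symm
  rw [← eLpNorm_zero (p := 2) (ε := ℝ)
    (μ := volume.restrict (Ω : Set (EuclideanSpace ℝ (Fin n))))]
  refine eLpNorm_congr_ae ?_
  filter_upwards [Lp.coeFn_zero ℝ 2
    (volume.restrict (Ω : Set (EuclideanSpace ℝ (Fin n))))] with x hx
  rw [hx]
  change (0 : ℝ) - 0 = 0
  ring

lemma isWeakPartial_zero (i : Fin n) : IsWeakPartial Ω i 0 0 := by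
  intro φ
  have h1 := integral_smul_mul 0 (0 : L2 Ω) φ
  have h2 := integral_smul_mul 0 (0 : L2 Ω) (pd i φ)
  rw [zero_smul, zero_mul] at h1 h2
  rw [h1, h2, neg_zero]

lemma memH20_zero : MemH20 Ω 0 :=
  ⟨0, 0, fun i => isWeakPartial_zero i, fun _ j => isWeakPartial_zero j, fun _ => 0,
    tendstoL2_zero, fun i => by simpa only [pd_zero, Pi.zero_apply] using tendstoL2_zero,
    fun i j => by simpa only [pd_zero, Pi.zero_apply] using tendstoL2_zero⟩

end Linearity

/-- The space of all `w ∈ H²₀(Ω)` with `Δ²w = Γ w` in `Ω`, that is, of the weak solutions of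
`Δ²w = Γ w` in `Ω`, `w = 0 = ∂w/∂n` on `∂Ω`. -/
def eigenspace (Ω : Opens (EuclideanSpace ℝ (Fin n))) (Γ : ℝ) : Submodule ℝ (L2 Ω) where
  carrier := {w | MemH20 Ω w ∧ SolvesPlateEquation Ω Γ w}
  add_mem' := by
    rintro u v ⟨hu, hu'⟩ ⟨hv, hv'⟩
    refine ⟨hu.add hv, fun φ => ?_⟩
    rw [integral_add_mul, integral_add_mul, hu' φ, hv' φ]
    ring
  zero_mem' := by
    refine ⟨memH20_zero, fun φ => ?_⟩
    have h1 := integral_smul_mul 0 (0 : L2 Ω) φ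
    have h2 := integral_smul_mul 0 (0 : L2 Ω) (lap (lap φ))
    rw [zero_smul, zero_mul] at h1 h2
    rw [h1, h2, mul_zero]
  smul_mem' := by
    rintro c u ⟨hu, hu'⟩
    refine ⟨hu.smul c, fun φ => ?_⟩
    rw [integral_smul_mul, integral_smul_mul, hu' φ]
    ring

/-- `Γ 0 ≤ Γ 1 ≤ Γ 2 ≤ …` is the list of the clamped plate eigenvalues of `Ω`, each repeated
according to its multiplicity: every real `t` occurs in it exactly `dim (eigenspace Ω t)` times
(so not at all if `t` is not an eigenvalue). The entry `Γ k` is the `(k+1)`-st eigenvalue. -/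
structure IsEigenvalueList (Ω : Opens (EuclideanSpace ℝ (Fin n))) (Γ : ℕ → ℝ) : Prop where
  monotone : Monotone Γ
  multiplicity : ∀ t : ℝ, Cardinal.mk {k : ℕ // Γ k = t} = Module.rank ℝ (eigenspace Ω t)

end ClampedPlate

end

noncomputable section

namespace ClampedPlate

/-! On a bounded Ω the norms ‖u‖ and ‖∂ᵢu‖ are controlled by ‖Δu‖ for test functions, so u ↦ Δu
identifies H²₀(Ω) with a closed subspace `energySpace Ω` of L²(Ω). Let `embed` be the inverse map.
Tested against φ, the plate equation for u = `embed` g becomes g = Γ · `embed`* `embed` g. Plate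
eigenvalues are thus the reciprocals of the eigenvalues of `solOp` = `embed`* `embed`, which is
positive, injective and symmetric. It is also compact, by a Poincaré inequality on small cubes
(`exists_finiteDimensional_approx`), and the spectral theorem produces the list.

For the inequality, let u be a first eigenfunction with ‖Δu‖ = 1, so that ‖u‖² = 1/γ with γ = Γ₁.
The trial functions are a·u with a(x) = ⟪v, x⟫ - c and |v| = 1. If a·u is orthogonal to the
eigenfunctions that precede γ', then γ'‖au‖² ≤ ‖Δ(au)‖². Two identities enter (`norm_lap_mulAff_sq`,
`norm_sq_eq_inner_dirDeriv`): ‖Δ(au)‖² = γ‖au‖² + 4‖∂ᵥu‖² + 2‖∇u‖², and ‖u‖² = -2⟪∂ᵥu, au⟫. The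
second bounds ‖au‖ from below. With ‖∇u‖² ≤ ‖u‖‖Δu‖ = 1/√γ, a perfect square appears and √γ' ≤ √γ +
4γ‖∂ᵥu‖² (`sqrt_le_sqrt_add`).

Gram–Schmidt in ℝⁿ yields an orthonormal basis whose i-th direction and a suitable c give a trial
function admissible for the eigenvalue Γᵢ₊₁. Summing over the basis, Σ‖∂ᵥu‖² = ‖∇u‖² ≤ 1/√γ, which
gives n√γ + 4√γ. -/

lemma nonempty_orderIso_nat {I : Type*} [LinearOrder I] [Infinite I]
    (h : ∀ i : I, (Set.Iic i).Finite) : Nonempty (ℕ ≃o I) := by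
  classical
  obtain ⟨i₀⟩ : Nonempty I := inferInstance
  obtain ⟨b, hb, hmin⟩ := (h i₀).exists_minimal ⟨i₀, le_rfl⟩
  let : OrderBot I :=
    { bot := b
      bot_le := fun i => by
        rcases le_total i b with hi | hi
        · exact hmin (hi.trans hb) hi
        · exact hi }
  have : NoMaxOrder I := ⟨fun i => by
    by_contra! hi
    exact Set.infinite_univ ((h i).subset fun j _ => hi j)⟩
  let : LocallyFiniteOrder I :=
    LocallyFiniteOrder.ofFiniteIcc fun i j => (h j).subset Set.Icc_subset_Iic_self
  let := LinearLocallyFiniteOrder.succOrder I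
  let := LinearLocallyFiniteOrder.predOrder I
  exact ⟨orderIsoNatOfLinearSuccPredArch.symm⟩

/-! ### Spectral theory of a positive compact symmetric operator -/

section Compact

variable {G : Type} [NormedAddCommGroup G] [InnerProductSpace ℝ G] {T : G →L[ℝ] G}

/-- By orthogonality ‖μᵢeᵢ - μⱼeⱼ‖² = μᵢ² + μⱼ² ≥ ε², so infinitely many such images could have no
Cauchy subsequence. -/
lemma finite_setOf_le_of_isCompactOperator (hc : IsCompactOperator T) {ι : Type*} {e : ι → G}
    (he : Orthonormal ℝ e) {μ : ι → ℝ} (hT : ∀ i, T (e i) = μ i • e i) {ε : ℝ} (hε : 0 < ε) :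
    {i | ε ≤ μ i}.Finite := by
  by_contra hinf
  let f := Set.Infinite.natEmbedding _ hinf
  obtain ⟨S, hS, hTS⟩ := hc.image_closedBall_subset_compact (f := (T : G →ₗ[ℝ] G)) 1
  have hmem (k : ℕ) : T (e (f k)) ∈ S :=
    hTS ⟨e (f k), by simp [he.1], rfl⟩
  obtain ⟨a, -, φ, hφ, hlim⟩ := hS.tendsto_subseq hmem
  obtain ⟨N, hN⟩ := Metric.cauchySeq_iff'.1 hlim.cauchySeq ε hε
  have h1 := hN (N + 1) N.le_succ
  have hne : (f (φ (N + 1)) : ι) ≠ f (φ N) := fun h =>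
    (hφ N.lt_succ_self).ne' (f.injective (Subtype.ext h))
  simp only [Function.comp_apply, dist_eq_norm, hT] at h1
  have h2 := norm_sub_sq_real (μ (f (φ (N + 1))) • e (f (φ (N + 1)))) (μ (f (φ N)) • e (f (φ N)))
  rw [real_inner_smul_left, real_inner_smul_right, he.2 hne, norm_smul, norm_smul, he.1, he.1,
    Real.norm_eq_abs, Real.norm_eq_abs, mul_one, mul_one, sq_abs, sq_abs] at h2
  have h3 : ε ≤ μ (f (φ (N + 1))) := (f (φ (N + 1))).2
  have h4 := sq_lt_sq₀ (norm_nonneg _) hε.le |>.2 h1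
  nlinarith [sq_nonneg (μ (f (φ N)))]

variable (hpos : ∀ g ≠ 0, 0 < inner ℝ (T g) g)

include hpos in
lemma eigenspace_eq_bot_of_nonpos {μ : ℝ} (hμ : μ ≤ 0) :
    Module.End.eigenspace (T : G →ₗ[ℝ] G) μ = ⊥ := by
  rw [Submodule.eq_bot_iff]
  intro g hg
  by_contra h
  have h1 := hpos g h
  rw [show T g = μ • g from Module.End.mem_eigenspace_iff.1 hg, real_inner_smul_left,
    real_inner_self_eq_norm_sq] at h1
  nlinarith [sq_nonneg ‖g‖]

variable [CompleteSpace G]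

include hpos in
lemma finiteDimensional_eigenspace (hc : IsCompactOperator T) (μ : ℝ) :
    FiniteDimensional ℝ (Module.End.eigenspace (T : G →ₗ[ℝ] G) μ) := by
  rcases eq_or_ne μ 0 with rfl | hμ
  · rw [eigenspace_eq_bot_of_nonpos hpos le_rfl]
    infer_instance
  · exact ContinuousLinearMap.finite_dimensional_eigenspace hc μ hμ

variable (hs : (T : G →ₗ[ℝ] G).IsSymmetric)

include hpos hs in
-- The index t is the reciprocal of the eigenvalue. Since 0⁻¹ = 0, the index t = 0 stands for the
-- kernel, which is trivial by positivity, so its fibre is empty.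
lemma exists_orthonormal_eigenvectors (hc : IsCompactOperator T) :
    ∃ e : (Σ t : ℝ, Fin (Module.finrank ℝ (Module.End.eigenspace (T : G →ₗ[ℝ] G) t⁻¹))) → G,
      Orthonormal ℝ e ∧ (∀ i, T (e i) = i.1⁻¹ • e i) ∧
        (Submodule.span ℝ (Set.range e))ᗮ = ⊥ := by
  have (t : ℝ) := finiteDimensional_eigenspace hpos hc t⁻¹
  let b (t : ℝ) := stdOrthonormalBasis ℝ (Module.End.eigenspace (T : G →ₗ[ℝ] G) t⁻¹)
  refine ⟨fun i => b i.1 i.2, ?_, fun i => Module.End.mem_eigenspace_iff.1 (b i.1 i.2).2, ?_⟩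
  · exact (hs.orthogonalFamily_eigenspaces.comp inv_injective).orthonormal_sigma_orthonormal
      fun t => (b t).orthonormal
  · rw [eq_bot_iff, ← ContinuousLinearMap.orthogonalComplement_iSup_eigenspaces_eq_bot hc hs]
    refine Submodule.orthogonal_le (iSup_le fun μ x hx => ?_)
    obtain ⟨t, rfl⟩ : ∃ t : ℝ, μ = t⁻¹ := ⟨μ⁻¹, (inv_inv μ).symm⟩
    have h := (b t).sum_repr ⟨x, hx⟩
    have h' : x = ∑ i, (b t).repr ⟨x, hx⟩ i • (b t i : G) := by
      have := congrArg (Submodule.subtype _) h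
      simpa using this.symm
    rw [h']
    exact Submodule.sum_mem _ fun i _ => Submodule.smul_mem _ _
      (Submodule.subset_span ⟨⟨t, i⟩, rfl⟩)

include hpos hs in
lemma exists_monotone_eigenvalue_list (hc : IsCompactOperator T)
    (hinf : ¬ FiniteDimensional ℝ G) :
    ∃ Γ : ℕ → ℝ, Monotone Γ ∧ ∀ t : ℝ, Cardinal.mk {k : ℕ // Γ k = t}
      = Module.rank ℝ (Module.End.eigenspace (T : G →ₗ[ℝ] G) t⁻¹) := by
  obtain ⟨e, he, heT, hspan⟩ := exists_orthonormal_eigenvectors hpos hs hc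
  let F (t : ℝ) := Fin (Module.finrank ℝ (Module.End.eigenspace (T : G →ₗ[ℝ] G) t⁻¹))
  have hipos (i : Σ t, F t) : 0 < i.1 := by
    have h := hpos (e i) (he.ne_zero i)
    rw [heT, real_inner_smul_left, real_inner_self_eq_norm_sq, he.1] at h
    simpa using h
  have : Infinite (Σₗ t, F t) := by
    by_contra hfin
    have : Finite (Σ t, F t) := not_infinite_iff_finite.1 hfin
    have := FiniteDimensional.span_of_finite ℝ (Set.finite_range e)
    rw [Submodule.orthogonal_eq_bot_iff] at hspan
    exact hinf (Module.finite_def.2 (hspan ▸ (Submodule.fg_iff_finiteDimensional _).2 this))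
  -- In the lexicographic order the predecessors of i have eigenvalues at least that of i, so
  -- compactness leaves finitely many. An infinite linear order with finite initial segments is a
  -- copy of ℕ.
  have hfin (i : Σₗ t, F t) : (Set.Iic i).Finite := by
    refine (finite_setOf_le_of_isCompactOperator hc he heT
      (ε := (ofLex i).1⁻¹) (inv_pos.2 (hipos _))).subset fun j hj => ?_
    have hj' : (ofLex j).1 ≤ (ofLex i).1 := by
      rcases Sigma.Lex.le_def.1 hj with h | ⟨h, -⟩
      · exact h.le
      · exact h.le
    exact inv_anti₀ (hipos _) hj'
  obtain ⟨o⟩ := nonempty_orderIso_nat hfin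
  refine ⟨fun k => (ofLex (o k)).1, fun j k hjk => ?_, fun t => ?_⟩
  · rcases Sigma.Lex.le_def.1 (o.monotone hjk) with h | ⟨h, -⟩
    · exact h.le
    · exact h.le
  · have := finiteDimensional_eigenspace hpos hc t⁻¹
    have e1 : {k : ℕ // (ofLex (o k)).1 = t} ≃ {i : Σ t, F t // i.1 = t} :=
      o.toEquiv.subtypeEquiv fun k => Iff.rfl
    rw [Cardinal.mk_congr (e1.trans (Equiv.sigmaSubtype t)), Cardinal.mk_fin,
      Module.finrank_eq_rank]

include hpos hs in
-- Equal cardinalities allow the eigenbasis to be matched with an arbitrary list fibre by fibre;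
-- this makes the final estimate valid for every admissible list.
lemma exists_orthonormal_of_eigenvalue_list (hc : IsCompactOperator T) {Γ : ℕ → ℝ}
    (hΓ : ∀ t : ℝ, Cardinal.mk {k : ℕ // Γ k = t}
      = Module.rank ℝ (Module.End.eigenspace (T : G →ₗ[ℝ] G) t⁻¹)) :
    ∃ e : ℕ → G, Orthonormal ℝ e ∧ (∀ k, T (e k) = (Γ k)⁻¹ • e k) ∧
      (Submodule.span ℝ (Set.range e))ᗮ = ⊥ := by
  obtain ⟨e, he, heT, hspan⟩ := exists_orthonormal_eigenvectors hpos hs hc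
  have h (t : ℝ) : Nonempty ({k : ℕ // Γ k = t} ≃
      Fin (Module.finrank ℝ (Module.End.eigenspace (T : G →ₗ[ℝ] G) t⁻¹))) := by
    have := finiteDimensional_eigenspace hpos hc t⁻¹
    rw [← Cardinal.eq, hΓ, Cardinal.mk_fin, Module.finrank_eq_rank]
  let σ t := (h t).some
  let τ := (Equiv.sigmaFiberEquiv Γ).symm.trans (Equiv.sigmaCongrRight σ)
  refine ⟨e ∘ τ, he.comp _ τ.injective, fun k => heT (τ k), ?_⟩
  rwa [τ.surjective.range_comp]

include hpos in
-- The variational bound: in the expansion along the eigenbasis the terms j < k vanish, and the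
-- others carry (Γ j)⁻¹ ≤ (Γ k)⁻¹.
lemma inner_apply_self_le_of_orthogonal {Γ : ℕ → ℝ} (hΓ : Monotone Γ) {e : ℕ → G}
    (he : Orthonormal ℝ e) (heT : ∀ k, T (e k) = (Γ k)⁻¹ • e k) (hs : (T : G →ₗ[ℝ] G).IsSymmetric)
    (hspan : (Submodule.span ℝ (Set.range e))ᗮ = ⊥) {k : ℕ} {g : G}
    (hg : ∀ j < k, inner ℝ (e j) g = 0) :
    inner ℝ (T g) g ≤ (Γ k)⁻¹ * ‖g‖ ^ 2 := by
  have hΓpos (j : ℕ) : 0 < Γ j := by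
    have h := hpos (e j) (he.ne_zero j)
    rw [heT, real_inner_smul_left, real_inner_self_eq_norm_sq, he.1] at h
    simpa using h
  let b := HilbertBasis.mkOfOrthogonalEqBot he hspan
  have hb (j : ℕ) : b j = e j := by simp [b]
  have h1 := b.hasSum_inner_mul_inner (T g) g
  have h2 := (b.hasSum_inner_mul_inner g g).mul_left (Γ k)⁻¹
  rw [real_inner_self_eq_norm_sq] at h2
  refine hasSum_le (fun j => ?_) h1 h2
  have h3 : inner ℝ (T g) (e j) = (Γ j)⁻¹ * inner ℝ g (e j) := by
    rw [← real_inner_smul_right, ← heT]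
    exact hs g (e j)
  rw [hb, h3, mul_assoc]
  rcases lt_or_ge j k with hj | hj
  · rw [hg j hj, mul_zero, mul_zero, mul_zero]
  · refine mul_le_mul_of_nonneg_right (inv_anti₀ (hΓpos k) (hΓ hj)) ?_
    rw [real_inner_comm]
    exact mul_self_nonneg _

end Compact

/-! ### Poincaré inequality on bounded convex sets -/

section Poincare

variable {E : Type*} [NormedAddCommGroup E] [NormedSpace ℝ E]

lemma sq_intervalIntegral_le {u : ℝ → ℝ} (hu : Continuous u) :
    (∫ t in (0 : ℝ)..1, u t) ^ 2 ≤ ∫ t in (0 : ℝ)..1, u t ^ 2 := by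
  set m := ∫ t in (0 : ℝ)..1, u t with hm
  have h1 : 0 ≤ ∫ t in (0 : ℝ)..1, (u t - m) ^ 2 :=
    intervalIntegral.integral_nonneg zero_le_one fun t _ => sq_nonneg _
  have h2 : ∫ t in (0 : ℝ)..1, (u t - m) ^ 2
      = (∫ t in (0 : ℝ)..1, u t ^ 2) - 2 * m * m + m ^ 2 := by
    rw [show (fun t => (u t - m) ^ 2) = fun t => u t ^ 2 - 2 * m * u t + m ^ 2 by ext; ring,
      intervalIntegral.integral_add, intervalIntegral.integral_sub,
      intervalIntegral.integral_const_mul, ← hm]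
    · simp
    all_goals exact Continuous.intervalIntegrable (by fun_prop) _ _
  nlinarith

/-- Fundamental theorem of calculus along the segment, then Cauchy–Schwarz. F plays the role of
|∇f|²; its nonnegativity follows from `hfF` once y ≠ x. -/
lemma enorm_sub_sq_le_lintegral {f F : E → ℝ} (hf : ContDiff ℝ 1 f) (hF : Continuous F)
    (hfF : ∀ z v, (fderiv ℝ f z v) ^ 2 ≤ F z * ‖v‖ ^ 2) {h : ℝ} {x y : E} (hxy : ‖y - x‖ ≤ h) :
    ‖f x - f y‖ₑ ^ 2 ≤ ENNReal.ofReal (h ^ 2) *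
      ∫⁻ t in Set.Ioc (0 : ℝ) 1, ENNReal.ofReal (F (x + t • (y - x))) := by
  have hF0 (z : E) (hz : y ≠ x) : 0 ≤ F z := by
    have h1 := (sq_nonneg _).trans (hfF z (y - x))
    have h2 : 0 < ‖y - x‖ ^ 2 := by have := norm_pos_iff.2 (sub_ne_zero.2 hz); positivity
    exact nonneg_of_mul_nonneg_left h1 h2
  rcases eq_or_ne y x with rfl | hne
  · simp
  have hcont : Continuous fun t : ℝ => fderiv ℝ f (x + t • (y - x)) (y - x) :=
    ((hf.continuous_fderiv one_ne_zero).comp (by fun_prop)).clm_apply continuous_const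
  have hint : ∫ t in (0 : ℝ)..1, fderiv ℝ f (x + t • (y - x)) (y - x) = f y - f x := by
    have := intervalIntegral.integral_eq_sub_of_hasDerivAt (a := 0) (b := 1)
      (f := fun t : ℝ => f (x + t • (y - x)))
      (f' := fun t : ℝ => fderiv ℝ f (x + t • (y - x)) (y - x)) (fun t _ => ?_)
      (hcont.intervalIntegrable _ _)
    · simpa using this
    · have h1 : HasDerivAt (fun t : ℝ => x + t • (y - x)) (y - x) t := by
        simpa using ((hasDerivAt_id t).smul_const (y - x)).const_add x
      exact ((hf.differentiable one_ne_zero _).hasFDerivAt).comp_hasDerivAt t h1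
  have hFc : Continuous fun t : ℝ => F (x + t • (y - x)) := hF.comp (by fun_prop)
  have key : (f x - f y) ^ 2 ≤ h ^ 2 * ∫ t in Set.Ioc (0 : ℝ) 1, F (x + t • (y - x)) := by
    rw [← neg_sub, neg_sq, ← hint, ← intervalIntegral.integral_of_le zero_le_one,
      ← intervalIntegral.integral_const_mul]
    refine (sq_intervalIntegral_le hcont).trans (intervalIntegral.integral_mono_on zero_le_one
      ((hcont.pow 2).intervalIntegrable _ _) ((hFc.const_mul _).intervalIntegrable _ _)
      fun t _ => (hfF _ _).trans ?_)
    rw [mul_comm]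
    have := hF0 (x + t • (y - x)) hne
    gcongr
  rw [← ofReal_integral_eq_lintegral_ofReal
    (hFc.integrableOn_Icc.mono_set Set.Ioc_subset_Icc_self) (.of_forall fun t => hF0 _ hne),
    ← ENNReal.ofReal_mul (sq_nonneg h), Real.enorm_eq_ofReal_abs,
    ← ENNReal.ofReal_pow (abs_nonneg _), sq_abs]
  exact ENNReal.ofReal_le_ofReal key

variable [FiniteDimensional ℝ E] [MeasurableSpace E] [BorelSpace E] (μ : Measure E)
  [μ.IsAddHaarMeasure]

lemma lintegral_comp_add_smul {F : E → ℝ≥0∞} (hF : Measurable F) (a : E) {t : ℝ} (ht : t ≠ 0) :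
    ∫⁻ y, F (a + t • y) ∂μ
      = ENNReal.ofReal |(t ^ Module.finrank ℝ E)⁻¹| * ∫⁻ y, F y ∂μ := by
  rw [← lintegral_add_left_eq_self F a, ← smul_eq_mul, ← lintegral_smul_measure,
    ← Measure.map_addHaar_smul μ ht, lintegral_map (by fun_prop) (by fun_prop)]

lemma lintegral_convex_comb_le {A : Set E} (hA : Convex ℝ A) (hAm : MeasurableSet A)
    {F : E → ℝ≥0∞} (hF : Measurable F) {x : E} (hx : x ∈ A) {t : ℝ} (ht : 2⁻¹ ≤ t) (ht1 : t ≤ 1) :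
    ∫⁻ y in A, F ((1 - t) • x + t • y) ∂μ ≤ 2 ^ Module.finrank ℝ E * ∫⁻ y in A, F y ∂μ := by
  have ht0 : 0 < t := lt_of_lt_of_le (by norm_num) ht
  rw [← lintegral_indicator hAm F, ← lintegral_indicator hAm]
  calc ∫⁻ y, A.indicator (fun y => F ((1 - t) • x + t • y)) y ∂μ
      ≤ ∫⁻ y, A.indicator F ((1 - t) • x + t • y) ∂μ := by
        refine lintegral_mono (Set.indicator_le fun y hy => ?_)
        rw [Set.indicator_of_mem (hA hx hy (by linarith) ht0.le (by ring))]
    _ = ENNReal.ofReal |(t ^ Module.finrank ℝ E)⁻¹| * ∫⁻ y, A.indicator F y ∂μ :=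
        lintegral_comp_add_smul μ (hF.indicator hAm) _ ht0.ne'
    _ ≤ _ := by
        gcongr
        rw [← inv_pow, abs_of_pos (by positivity), ENNReal.ofReal_pow (by positivity)]
        gcongr
        rw [show (2 : ℝ≥0∞) = ENNReal.ofReal 2 by simp]
        exact ENNReal.ofReal_le_ofReal (inv_le_of_inv_le₀ (by norm_num) ht)

/-- At each t, integrate first over the endpoint whose weight is at least 1/2: the substitution z =
(1 - t)x + ty then costs at most 2ⁿ, where n is the dimension, and convexity keeps z in A. -/
lemma lintegral_lintegral_segment_le {A : Set E} (hA : Convex ℝ A) (hAm : MeasurableSet A)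
    {F : E → ℝ≥0∞} (hF : Measurable F) :
    ∫⁻ x in A, ∫⁻ y in A, (∫⁻ t in Set.Ioc (0 : ℝ) 1, F (x + t • (y - x))) ∂μ ∂μ
      ≤ 2 ^ Module.finrank ℝ E * μ A * ∫⁻ y in A, F y ∂μ := by
  have hseg (x y : E) (t : ℝ) : x + t • (y - x) = (1 - t) • x + t • y := by module
  have key (t : ℝ) (ht : t ∈ Set.Ioc (0 : ℝ) 1) :
      ∫⁻ x in A, ∫⁻ y in A, F (x + t • (y - x)) ∂μ ∂μ
        ≤ 2 ^ Module.finrank ℝ E * μ A * ∫⁻ y in A, F y ∂μ := by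
    have hconst : ∫⁻ _ in A, (2 ^ Module.finrank ℝ E * ∫⁻ y in A, F y ∂μ) ∂μ
        = 2 ^ Module.finrank ℝ E * μ A * ∫⁻ y in A, F y ∂μ := by
      rw [setLIntegral_const]
      ring
    simp only [hseg]
    rcases le_total 2⁻¹ t with h | h
    · rw [← hconst]
      exact setLIntegral_mono' hAm fun x hx => lintegral_convex_comb_le μ hA hAm hF hx h ht.2
    · rw [lintegral_lintegral_swap (by fun_prop), ← hconst]
      refine setLIntegral_mono' hAm fun y hy => ?_
      have := lintegral_convex_comb_le μ hA hAm hF hy (t := 1 - t) (by linarith)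
        (by linarith [ht.1])
      simpa only [sub_sub_cancel, add_comm] using this
  calc ∫⁻ x in A, ∫⁻ y in A, (∫⁻ t in Set.Ioc (0 : ℝ) 1, F (x + t • (y - x))) ∂μ ∂μ
      = ∫⁻ x in A, (∫⁻ t in Set.Ioc (0 : ℝ) 1, ∫⁻ y in A, F (x + t • (y - x)) ∂μ) ∂μ := by
        refine lintegral_congr fun x => ?_
        rw [lintegral_lintegral_swap (by fun_prop)]
    _ = ∫⁻ t in Set.Ioc (0 : ℝ) 1, ∫⁻ x in A, ∫⁻ y in A, F (x + t • (y - x)) ∂μ ∂μ := by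
        rw [lintegral_lintegral_swap]
        refine (Measurable.lintegral_prod_right' (ν := μ.restrict A)
          (f := fun p : (E × ℝ) × E => F (p.1.1 + p.1.2 • (p.2 - p.1.1))) ?_).aemeasurable
        fun_prop
    _ ≤ ∫⁻ _ in Set.Ioc (0 : ℝ) 1, 2 ^ Module.finrank ℝ E * μ A * ∫⁻ y in A, F y ∂μ :=
        setLIntegral_mono' measurableSet_Ioc key
    _ = _ := by simp

/-- The constant c is a value f y instead of the mean: some y makes ∫|f - f y|² no larger than its
average over y. -/
lemma exists_lintegral_sub_sq_le {A : Set E} (hA : Convex ℝ A) (hAm : MeasurableSet A)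
    (hAf : μ A ≠ ∞) {h : ℝ} (hAh : ∀ x ∈ A, ∀ y ∈ A, ‖y - x‖ ≤ h) {f F : E → ℝ}
    (hf : ContDiff ℝ 1 f) (hF : Continuous F)
    (hfF : ∀ z v, (fderiv ℝ f z v) ^ 2 ≤ F z * ‖v‖ ^ 2) :
    ∃ c, ∫⁻ x in A, ‖f x - c‖ₑ ^ 2 ∂μ ≤ 2 ^ Module.finrank ℝ E * ENNReal.ofReal (h ^ 2) *
      ∫⁻ x in A, ENNReal.ofReal (F x) ∂μ := by
  rcases eq_or_ne (μ A) 0 with h0 | h0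
  · exact ⟨0, by simp [Measure.restrict_eq_zero.2 h0]⟩
  have hfc := hf.continuous
  obtain ⟨y, hy, hle⟩ := exists_le_setLAverage h0 hAf
    (f := fun x => ∫⁻ y in A, ‖f x - f y‖ₑ ^ 2 ∂μ)
    (Measurable.lintegral_prod_right' (ν := μ.restrict A)
      (f := fun p : E × E => ‖f p.1 - f p.2‖ₑ ^ 2) (by fun_prop)).aemeasurable
  refine ⟨f y, ?_⟩
  have h1 : ∫⁻ x in A, ∫⁻ y in A, ‖f x - f y‖ₑ ^ 2 ∂μ ∂μ
      ≤ ENNReal.ofReal (h ^ 2) * (2 ^ Module.finrank ℝ E * μ A *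
        ∫⁻ y in A, ENNReal.ofReal (F y) ∂μ) := by
    refine le_trans ?_ (mul_le_mul_right (lintegral_lintegral_segment_le μ hA hAm
      (F := fun z => ENNReal.ofReal (F z)) (by fun_prop)) _)
    rw [← lintegral_const_mul' _ _ ENNReal.ofReal_ne_top]
    refine setLIntegral_mono' hAm fun x hx => ?_
    rw [← lintegral_const_mul' _ _ ENNReal.ofReal_ne_top]
    exact setLIntegral_mono' hAm fun y hy =>
      enorm_sub_sq_le_lintegral hf hF hfF (hAh x hx y hy)
  rw [setLAverage_eq] at hle
  calc ∫⁻ x in A, ‖f x - f y‖ₑ ^ 2 ∂μ = ∫⁻ x in A, ‖f y - f x‖ₑ ^ 2 ∂μ := by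
        simp only [← neg_sub (f y), enorm_neg]
    _ ≤ _ := hle
    _ ≤ _ := ENNReal.div_le_div_right h1 _
    _ = (2 ^ Module.finrank ℝ E * ENNReal.ofReal (h ^ 2) *
          ∫⁻ x in A, ENNReal.ofReal (F x) ∂μ) * (μ A / μ A) := by
        simp only [div_eq_mul_inv]
        ring
    _ = _ := by rw [ENNReal.div_self h0 hAf, mul_one]

end Poincare

/-! ### Compactness from finite-dimensional approximation -/

lemma norm_sub_starProjection_le {H : Type*} [NormedAddCommGroup H] [InnerProductSpace ℝ H]
    (W : Submodule ℝ H) [W.HasOrthogonalProjection] (x : H) {w : H} (hw : w ∈ W) :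
    ‖x - W.starProjection x‖ ≤ ‖x - w‖ := by
  rw [Submodule.starProjection_minimal]
  exact ciInf_le ⟨0, by rintro _ ⟨_, rfl⟩; exact norm_nonneg _⟩ (⟨w, hw⟩ : W)

/-- K is the norm limit of its compositions with the orthogonal projections onto the spaces W. The
projection is the best approximation, so the bound passes to it, and density extends it to all of G.
-/
lemma isCompactOperator_of_forall_exists_norm_sub_le {D G H : Type*} [NormedAddCommGroup G]
    [NormedSpace ℝ G] [NormedAddCommGroup H] [InnerProductSpace ℝ H] [CompleteSpace H]
    {d : D → G} (hd : DenseRange d) (K : G →L[ℝ] H)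
    (hK : ∀ ε > 0, ∃ W : Submodule ℝ H, FiniteDimensional ℝ W ∧
      ∀ φ, ∃ w ∈ W, ‖K (d φ) - w‖ ≤ ε * ‖d φ‖) : IsCompactOperator K := by
  choose! W hW hWK using hK
  have hpos (k : ℕ) : (0 : ℝ) < 1 / (k + 1) := Nat.one_div_pos_of_nat
  have hfin (k : ℕ) : FiniteDimensional ℝ (W (1 / (k + 1))) := hW _ (hpos k)
  refine isCompactOperator_of_tendsto (l := atTop)
    (F := fun k : ℕ => (W (1 / (k + 1))).starProjection ∘L K) ?_ (.of_forall fun k => ?_)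
  · rw [tendsto_iff_norm_sub_tendsto_zero]
    refine squeeze_zero (fun _ => norm_nonneg _) (fun k => ?_)
      tendsto_one_div_add_atTop_nhds_zero_nat
    refine ContinuousLinearMap.opNorm_le_bound _ (hpos k).le fun g => ?_
    refine hd.induction_on g (isClosed_le (by fun_prop) (by fun_prop)) fun φ => ?_
    obtain ⟨w, hw, hle⟩ := hWK _ (hpos k) φ
    rw [sub_apply, norm_sub_rev]
    exact (norm_sub_starProjection_le _ _ hw).trans hle
  · have : LocallyCompactSpace (W (1 / (k + 1))) := .of_finiteDimensional_of_complete ℝ _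
    exact (isCompactOperator_of_locallyCompactSpace_dom
      ((W (1 / (k + 1))).orthogonalProjectionOnto ∘L K)).clm_comp (Submodule.subtypeL _)

/-! ### The grid of half-open cubes -/

section Cubes

variable {n : ℕ}

/-- The cube of side `δ` with the corner `δ k`. -/
def cube (δ : ℝ) (k : Fin n → ℤ) : Set (EuclideanSpace ℝ (Fin n)) :=
  {x | ∀ i, ⌊x i / δ⌋ = k i}

lemma mem_cube_iff {δ : ℝ} (hδ : 0 < δ) {k : Fin n → ℤ} {x : EuclideanSpace ℝ (Fin n)} :
    x ∈ cube δ k ↔ ∀ i, x i ∈ Set.Ico (k i * δ) ((k i + 1) * δ) := by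
  simp only [cube, Set.mem_ofPred_eq, Int.floor_eq_iff, le_div_iff₀ hδ, div_lt_iff₀ hδ,
    Set.mem_Ico]

lemma convex_cube {δ : ℝ} (hδ : 0 < δ) (k : Fin n → ℤ) : Convex ℝ (cube δ k) := by
  intro x hx y hy a b ha hb hab
  rw [mem_cube_iff hδ] at *
  exact fun i => convex_Ico _ _ (hx i) (hy i) ha hb hab

lemma measurableSet_cube (δ : ℝ) (k : Fin n → ℤ) : MeasurableSet (cube δ k) := by
  have : cube δ k = ⋂ i, (fun x : EuclideanSpace ℝ (Fin n) => ⌊x i / δ⌋) ⁻¹' {k i} := by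
    ext
    simp [cube]
  rw [this]
  exact MeasurableSet.iInter fun i => measurableSet_eq_fun (by fun_prop) measurable_const

lemma norm_sub_le_of_mem_cube {δ : ℝ} (hδ : 0 < δ) {k : Fin n → ℤ}
    {x y : EuclideanSpace ℝ (Fin n)} (hx : x ∈ cube δ k) (hy : y ∈ cube δ k) :
    ‖y - x‖ ≤ √n * δ := by
  rw [mem_cube_iff hδ] at hx hy
  rw [EuclideanSpace.norm_eq, ← Real.sqrt_sq hδ.le, ← Real.sqrt_mul (by positivity)]
  refine Real.sqrt_le_sqrt ?_
  refine (Finset.sum_le_card_nsmul _ _ (δ ^ 2) fun i _ => ?_).trans (by simp)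
  rw [Real.norm_eq_abs, sq_abs, PiLp.sub_apply]
  obtain ⟨h1, h2⟩ := hx i
  obtain ⟨h3, h4⟩ := hy i
  nlinarith

lemma volume_cube_ne_top {δ : ℝ} (hδ : 0 < δ) (k : Fin n → ℤ) : volume (cube δ k) ≠ ∞ :=
  (Bornology.IsBounded.measure_lt_top (Metric.isBounded_iff.2 ⟨√n * δ, fun x hx y hy => by
    rw [dist_comm, dist_eq_norm]
    exact norm_sub_le_of_mem_cube hδ hx hy⟩)).ne

lemma finite_floor_image {s : Set (EuclideanSpace ℝ (Fin n))} (hs : Bornology.IsBounded s)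
    {δ : ℝ} (hδ : 0 < δ) : ((fun x i => ⌊x i / δ⌋ : _ → Fin n → ℤ) '' s).Finite := by
  obtain ⟨R, hR⟩ := hs.exists_norm_le
  refine (Set.Finite.pi' fun _ : Fin n => Set.finite_Icc ⌊-R / δ⌋ ⌊R / δ⌋).subset ?_
  rintro _ ⟨x, hx, rfl⟩ i
  have h := abs_le.1 ((Real.norm_eq_abs _ ▸ PiLp.norm_apply_le x i).trans (hR x hx))
  exact ⟨Int.floor_mono (by gcongr; exact h.1), Int.floor_mono (by gcongr; exact h.2)⟩

end Cubes

/-! ### Integration by parts and a priori bounds for test functions -/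

section Plate

variable {n : ℕ} {Ω : Opens (EuclideanSpace ℝ (Fin n))}

lemma pd_apply (i : Fin n) (φ : 𝓓(Ω, ℝ)) (x : EuclideanSpace ℝ (Fin n)) :
    pd i φ x = fderiv ℝ φ x (EuclideanSpace.single i 1) := by
  change (TestFunction.lineDerivCLM ℝ _ φ : 𝓓(Ω, ℝ)) x = _
  rw [TestFunction.lineDerivCLM_eq_fderivCLM, TestFunction.fderivCLM_apply_of_le _ (by simp)]

lemma differentiable_testFunction (φ : 𝓓(Ω, ℝ)) : Differentiable ℝ φ :=
  φ.contDiff.differentiable (by simp)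

lemma pd_comm (i j : Fin n) (φ : 𝓓(Ω, ℝ)) : pd i (pd j φ) = pd j (pd i φ) := by
  have h (i j : Fin n) (x) : pd i (pd j φ) x =
      fderiv ℝ (fderiv ℝ φ) x (EuclideanSpace.single i 1) (EuclideanSpace.single j 1) := by
    have h1 : (pd j φ : EuclideanSpace ℝ (Fin n) → ℝ)
        = fun y => fderiv ℝ φ y (EuclideanSpace.single j 1) := funext (pd_apply j φ)
    have h2 : DifferentiableAt ℝ (fderiv ℝ φ) x :=
      (φ.contDiff.fderiv_right (m := 1) (WithTop.coe_le_coe.2 (le_top (a := (2 : ℕ∞))))).differentiable (by simp) x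
    rw [pd_apply, h1, fderiv_clm_apply h2 (differentiableAt_const _)]
    simp
  ext x
  rw [h, h]
  exact (φ.contDiff.contDiffAt.isSymmSndFDerivAt (by simpa using WithTop.coe_le_coe.2 (le_top (a := (2 : ℕ∞))))).eq _ _

/-- Partial differentiation of test functions, as a linear map. -/
def pdₗ (i : Fin n) : 𝓓(Ω, ℝ) →ₗ[ℝ] 𝓓(Ω, ℝ) where
  toFun := pd i
  map_add' := pd_add i
  map_smul' := pd_smul i

/-- The Laplacian of test functions, as a linear map. -/
def lapₗ : 𝓓(Ω, ℝ) →ₗ[ℝ] 𝓓(Ω, ℝ) := ∑ i, pdₗ i ∘ₗ pdₗ i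

lemma lapₗ_apply (φ : 𝓓(Ω, ℝ)) : lapₗ φ = lap φ := by
  simp [lapₗ, lap, pdₗ]

/-- The embedding of the test functions into `L²(Ω)`. -/
def toL2 : 𝓓(Ω, ℝ) →ₗ[ℝ] L2 Ω where
  toFun φ := (memLp_testFunction φ).toLp φ
  map_add' _ _ := rfl
  map_smul' _ _ := rfl

lemma coeFn_toL2 (φ : 𝓓(Ω, ℝ)) :
    toL2 φ =ᵐ[volume.restrict (Ω : Set (EuclideanSpace ℝ (Fin n)))] φ :=
  (memLp_testFunction φ).coeFn_toLp

lemma inner_toL2 (u : L2 Ω) (φ : 𝓓(Ω, ℝ)) :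
    inner ℝ u (toL2 φ) = ∫ x in (Ω : Set (EuclideanSpace ℝ (Fin n))), u x * φ x := by
  rw [L2.inner_def]
  refine integral_congr_ae ?_
  filter_upwards [coeFn_toL2 φ] with x hx
  rw [hx]
  simp [mul_comm]

lemma testFunction_eq_zero (φ : 𝓓(Ω, ℝ)) {x : EuclideanSpace ℝ (Fin n)} (hx : x ∉ Ω) :
    φ x = 0 :=
  image_eq_zero_of_notMem_tsupport fun h => hx (φ.tsupport_subset h)

lemma inner_toL2_toL2 (φ ψ : 𝓓(Ω, ℝ)) :
    inner ℝ (toL2 φ) (toL2 ψ) = ∫ x, φ x * ψ x := by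
  rw [inner_toL2, ← setIntegral_eq_integral_of_forall_compl_eq_zero (f := fun x => φ x * ψ x)
    (s := (Ω : Set (EuclideanSpace ℝ (Fin n))))
    fun x hx => by rw [testFunction_eq_zero φ hx, zero_mul]]
  refine integral_congr_ae ?_
  filter_upwards [coeFn_toL2 φ] with x hx
  rw [hx]

lemma integrable_testFunction_mul (φ ψ : 𝓓(Ω, ℝ)) : Integrable fun x => φ x * ψ x :=
  (φ.continuous.mul ψ.continuous).integrable_of_hasCompactSupport φ.hasCompactSupport.mul_right

lemma inner_pd (i : Fin n) (φ ψ : 𝓓(Ω, ℝ)) :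
    inner ℝ (toL2 (pd i φ)) (toL2 ψ) = -inner ℝ (toL2 φ) (toL2 (pd i ψ)) := by
  rw [inner_toL2_toL2, inner_toL2_toL2]
  have := integral_mul_fderiv_eq_neg_fderiv_mul_of_integrable (μ := volume) (𝕜 := ℝ)
    (f := φ) (g := ψ) (v := EuclideanSpace.single i 1)
    (by simpa only [← pd_apply] using integrable_testFunction_mul (pd i φ) ψ)
    (by simpa only [← pd_apply] using integrable_testFunction_mul φ (pd i ψ))
    (integrable_testFunction_mul φ ψ)
    (fun x _ => differentiable_testFunction φ x) (fun x _ => differentiable_testFunction ψ x)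
  simp only [← pd_apply] at this
  linarith

/-- Multiplication of test functions by the affine function `x ↦ ⟪v, x⟫ - c`. -/
def mulAff (v : EuclideanSpace ℝ (Fin n)) (c : ℝ) : 𝓓(Ω, ℝ) →ₗ[ℝ] 𝓓(Ω, ℝ) where
  toFun φ := ⟨fun x => (inner ℝ v x - c) * φ x,
    ((contDiff_const.inner ℝ contDiff_id).sub contDiff_const).mul φ.contDiff,
    φ.hasCompactSupport.mul_left,
    (tsupport_mul_subset_right).trans φ.tsupport_subset⟩
  map_add' φ ψ := by
    ext x
    exact mul_add _ (φ x) (ψ x)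
  map_smul' a φ := by
    ext x
    exact mul_left_comm _ a (φ x)

lemma mulAff_apply (v : EuclideanSpace ℝ (Fin n)) (c : ℝ) (φ : 𝓓(Ω, ℝ))
    (x : EuclideanSpace ℝ (Fin n)) : mulAff v c φ x = (inner ℝ v x - c) * φ x := rfl

lemma pd_mulAff (i : Fin n) (v : EuclideanSpace ℝ (Fin n)) (c : ℝ) (φ : 𝓓(Ω, ℝ)) :
    pd i (mulAff v c φ) = v i • φ + mulAff v c (pd i φ) := by
  ext x
  change _ = v i * φ x + (inner ℝ v x - c) * pd i φ x
  rw [pd_apply, pd_apply]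
  have h1 : HasFDerivAt (fun x => inner ℝ v x - c) (innerSL ℝ v) x :=
    (innerSL ℝ v).hasFDerivAt.sub_const c
  have h2 := h1.mul (differentiable_testFunction φ x).hasFDerivAt
  rw [show fderiv ℝ (mulAff v c φ) x = _ from h2.fderiv]
  simp [EuclideanSpace.inner_single_right]
  ring

/-- The derivative of a test function in the direction `v`. -/
def dirDeriv (v : EuclideanSpace ℝ (Fin n)) : 𝓓(Ω, ℝ) →ₗ[ℝ] 𝓓(Ω, ℝ) := ∑ i, v i • pdₗ i

lemma dirDeriv_apply (v : EuclideanSpace ℝ (Fin n)) (φ : 𝓓(Ω, ℝ)) :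
    dirDeriv v φ = ∑ i, v i • pd i φ := by
  simp [dirDeriv, pdₗ]

lemma dirDeriv_mulAff (v : EuclideanSpace ℝ (Fin n)) (c : ℝ) (φ : 𝓓(Ω, ℝ)) :
    dirDeriv v (mulAff v c φ) = ‖v‖ ^ 2 • φ + mulAff v c (dirDeriv v φ) := by
  have h : ∑ i, v i * v i = ‖v‖ ^ 2 := by
    rw [EuclideanSpace.norm_sq_eq]
    simp [sq]
  simp only [dirDeriv_apply, pd_mulAff, smul_add, Finset.sum_add_distrib, map_sum, map_smul,
    smul_smul, ← Finset.sum_smul, h]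

lemma lap_mulAff (v : EuclideanSpace ℝ (Fin n)) (c : ℝ) (φ : 𝓓(Ω, ℝ)) :
    lap (mulAff v c φ) = mulAff v c (lap φ) + (2 : ℝ) • dirDeriv v φ := by
  simp only [lap, dirDeriv_apply, pd_mulAff, pd_add, pd_smul, map_sum, Finset.smul_sum,
    ← Finset.sum_add_distrib]
  refine Finset.sum_congr rfl fun i _ => ?_
  module

lemma inner_mulAff (v : EuclideanSpace ℝ (Fin n)) (c : ℝ) (φ ψ : 𝓓(Ω, ℝ)) :
    inner ℝ (toL2 (mulAff v c φ)) (toL2 ψ) = inner ℝ (toL2 φ) (toL2 (mulAff v c ψ)) := by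
  rw [inner_toL2_toL2, inner_toL2_toL2]
  refine integral_congr_ae (.of_forall fun x => ?_)
  simp only [mulAff_apply]
  ring

lemma inner_mulAff_mulAff (v : EuclideanSpace ℝ (Fin n)) (c : ℝ) (φ : 𝓓(Ω, ℝ)) :
    inner ℝ (toL2 φ) (toL2 (mulAff v c (mulAff v c φ))) = ‖toL2 (mulAff v c φ)‖ ^ 2 := by
  rw [← inner_mulAff, real_inner_self_eq_norm_sq]

lemma inner_lap (φ ψ : 𝓓(Ω, ℝ)) :
    inner ℝ (toL2 (lap φ)) (toL2 ψ) = inner ℝ (toL2 φ) (toL2 (lap ψ)) := by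
  simp only [lap, map_sum, sum_inner, inner_sum, inner_pd, neg_neg]

lemma sum_norm_pd_sq (φ : 𝓓(Ω, ℝ)) :
    ∑ i, ‖toL2 (pd i φ)‖ ^ 2 = -inner ℝ (toL2 φ) (toL2 (lap φ)) := by
  simp only [lap, map_sum, inner_sum, ← real_inner_self_eq_norm_sq, inner_pd,
    Finset.sum_neg_distrib]

/-- Two integrations by parts turn ⟪∂ᵢ∂ᵢφ, ∂ⱼ∂ⱼφ⟫ into ‖∂ⱼ∂ᵢφ‖². Hence ‖Δφ‖ alone controls all
second derivatives. -/
lemma sum_norm_pd_pd_sq (φ : 𝓓(Ω, ℝ)) :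
    ∑ i, ∑ j, ‖toL2 (pd j (pd i φ))‖ ^ 2 = ‖toL2 (lap φ)‖ ^ 2 := by
  simp only [← real_inner_self_eq_norm_sq, lap, map_sum, inner_sum, sum_inner]
  rw [Finset.sum_comm]
  refine Finset.sum_congr rfl fun j _ => Finset.sum_congr rfl fun i _ => ?_
  rw [inner_pd, inner_pd i (pd i φ), pd_comm j i φ, pd_comm j i (pd j φ)]

lemma norm_pd_pd_le (i j : Fin n) (φ : 𝓓(Ω, ℝ)) :
    ‖toL2 (pd j (pd i φ))‖ ≤ ‖toL2 (lap φ)‖ := by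
  refine le_of_sq_le_sq ?_ (norm_nonneg _)
  rw [← sum_norm_pd_pd_sq]
  refine le_trans ?_ (Finset.single_le_sum (fun _ _ => by positivity) (Finset.mem_univ i))
  exact Finset.single_le_sum (f := fun j => ‖toL2 (pd j (pd i φ))‖ ^ 2)
    (fun _ _ => by positivity) (Finset.mem_univ j)

/-- Integrate by parts using ∂ᵥ(aφ) = |v|²φ + a ∂ᵥφ. It serves twice: for the Poincaré inequality on
Ω, and as the lower bound on ‖au‖ in the eigenvalue estimate. -/
lemma norm_sq_eq_inner_dirDeriv (v : EuclideanSpace ℝ (Fin n)) (c : ℝ) (φ : 𝓓(Ω, ℝ)) :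
    ‖v‖ ^ 2 * ‖toL2 φ‖ ^ 2 = -2 * inner ℝ (toL2 (dirDeriv v φ)) (toL2 (mulAff v c φ)) := by
  have h (ψ χ : 𝓓(Ω, ℝ)) : inner ℝ (toL2 (dirDeriv v ψ)) (toL2 χ)
      = -inner ℝ (toL2 ψ) (toL2 (dirDeriv v χ)) := by
    simp only [dirDeriv_apply, map_sum, map_smul, sum_inner, inner_sum, inner_smul_left,
      inner_smul_right, inner_pd, mul_neg, Finset.sum_neg_distrib]
    rfl
  have h1 := h φ (mulAff v c φ)
  rw [dirDeriv_mulAff, map_add, map_smul, inner_add_right, inner_smul_right,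
    real_inner_self_eq_norm_sq, ← inner_mulAff, real_inner_comm] at h1
  rw [real_inner_comm, inner_mulAff]
  linarith

/-- Compare Δ(aφ) = aΔφ + 2∂ᵥφ with Δ(a²φ) = a²Δφ + 4a∂ᵥφ + 2|v|²φ. The pairing with Δ(a²φ) is the
term that the eigenvalue equation evaluates. -/
lemma norm_lap_mulAff_sq (v : EuclideanSpace ℝ (Fin n)) (c : ℝ) (φ : 𝓓(Ω, ℝ)) :
    ‖toL2 (lap (mulAff v c φ))‖ ^ 2
      = inner ℝ (toL2 (lap φ)) (toL2 (lap (mulAff v c (mulAff v c φ))))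
        + 4 * ‖toL2 (dirDeriv v φ)‖ ^ 2 - 2 * ‖v‖ ^ 2 * inner ℝ (toL2 φ) (toL2 (lap φ)) := by
  have h1 : ‖toL2 (lap (mulAff v c φ))‖ ^ 2 = ‖toL2 (mulAff v c (lap φ))‖ ^ 2
      + 4 * inner ℝ (toL2 (mulAff v c (lap φ))) (toL2 (dirDeriv v φ))
      + 4 * ‖toL2 (dirDeriv v φ)‖ ^ 2 := by
    rw [lap_mulAff, map_add, map_smul, norm_add_sq_real, inner_smul_right, norm_smul]
    norm_num
    ring
  rw [h1, lap_mulAff v c (mulAff v c φ), dirDeriv_mulAff, lap_mulAff]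
  simp only [map_add, map_smul, inner_add_right, inner_smul_right, ← inner_mulAff_mulAff,
    ← inner_mulAff]
  rw [real_inner_comm (toL2 φ) (toL2 (lap φ))]
  ring

lemma exists_norm_mulAff_le (hΩ : Bornology.IsBounded (Ω : Set (EuclideanSpace ℝ (Fin n))))
    (v : EuclideanSpace ℝ (Fin n)) (c : ℝ) :
    ∃ C, ∀ φ : 𝓓(Ω, ℝ), ‖toL2 (mulAff v c φ)‖ ≤ C * ‖toL2 φ‖ := by
  obtain ⟨R, hR⟩ := hΩ.exists_norm_le
  refine ⟨‖v‖ * R + |c|, fun φ => Lp.norm_le_mul_norm_of_ae_le_mul ?_⟩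
  filter_upwards [coeFn_toL2 φ, coeFn_toL2 (mulAff v c φ),
    ae_restrict_mem Ω.isOpen.measurableSet] with x h1 h2 hx
  rw [h1, h2, mulAff_apply, norm_mul]
  gcongr
  refine (norm_sub_le _ _).trans (add_le_add ((norm_inner_le_norm v x).trans ?_) le_rfl)
  gcongr
  exact hR x hx

lemma exists_norm_le_pd (hΩ : Bornology.IsBounded (Ω : Set (EuclideanSpace ℝ (Fin n))))
    (i : Fin n) : ∃ C, 0 ≤ C ∧ ∀ φ : 𝓓(Ω, ℝ), ‖toL2 φ‖ ≤ C * ‖toL2 (pd i φ)‖ := by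
  obtain ⟨C, hC⟩ := exists_norm_mulAff_le hΩ (EuclideanSpace.single i 1) 0
  refine ⟨2 * |C|, by positivity, fun φ => ?_⟩
  have h := norm_sq_eq_inner_dirDeriv (EuclideanSpace.single i 1) 0 φ
  have h1 : dirDeriv (EuclideanSpace.single i (1 : ℝ)) φ = pd i φ := by
    simp [dirDeriv_apply, PiLp.single_apply, ite_smul]
  rw [h1] at h
  have h2 := abs_real_inner_le_norm (toL2 (pd i φ)) (toL2 (mulAff (EuclideanSpace.single i 1) 0 φ))
  have h3 : ‖toL2 (mulAff (EuclideanSpace.single i 1) 0 φ)‖ ≤ |C| * ‖toL2 φ‖ :=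
    (hC φ).trans (by gcongr; exact le_abs_self C)
  have h4 := mul_le_mul_of_nonneg_left h3 (norm_nonneg (toL2 (pd i φ)))
  simp only [PiLp.norm_single, norm_one, one_pow, one_mul] at h
  rcases (norm_nonneg (toL2 φ)).eq_or_lt with h0 | h0
  · rw [← h0]; positivity
  · refine le_of_mul_le_mul_right ?_ h0
    have := neg_abs_le (inner ℝ (toL2 (pd i φ))
      (toL2 (mulAff (EuclideanSpace.single i 1) 0 φ)))
    nlinarith

lemma norm_pd_sq_le (i : Fin n) (φ : 𝓓(Ω, ℝ)) :
    ‖toL2 (pd i φ)‖ ^ 2 ≤ ‖toL2 φ‖ * ‖toL2 (lap φ)‖ := by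
  refine (Finset.single_le_sum (f := fun i => ‖toL2 (pd i φ)‖ ^ 2) (fun _ _ => by positivity)
    (Finset.mem_univ i)).trans ?_
  rw [sum_norm_pd_sq]
  exact (neg_le_abs _).trans (abs_real_inner_le_norm _ _)

/-- ‖∂ᵢφ‖² ≤ ‖φ‖‖Δφ‖ ≤ C‖∂ᵢφ‖‖Δφ‖; cancel one factor. -/
lemma exists_norm_pd_le (hΩ : Bornology.IsBounded (Ω : Set (EuclideanSpace ℝ (Fin n))))
    (i : Fin n) : ∃ C, ∀ φ : 𝓓(Ω, ℝ), ‖toL2 (pd i φ)‖ ≤ C * ‖toL2 (lap φ)‖ := by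
  obtain ⟨C, hC0, hC⟩ := exists_norm_le_pd hΩ i
  refine ⟨C, fun φ => ?_⟩
  have h1 := norm_pd_sq_le i φ
  have h2 := mul_le_mul_of_nonneg_right (hC φ) (norm_nonneg (toL2 (lap φ)))
  rcases (norm_nonneg (toL2 (pd i φ))).eq_or_lt with h0 | h0
  · rw [← h0]; positivity
  · exact le_of_mul_le_mul_right (by nlinarith) h0

lemma exists_norm_le_lap (hn : 1 ≤ n)
    (hΩ : Bornology.IsBounded (Ω : Set (EuclideanSpace ℝ (Fin n)))) :
    ∃ C, ∀ φ : 𝓓(Ω, ℝ), ‖toL2 φ‖ ≤ C * ‖toL2 (lap φ)‖ := by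
  obtain ⟨C, hC0, hC⟩ := exists_norm_le_pd hΩ ⟨0, hn⟩
  obtain ⟨C', hC'⟩ := exists_norm_pd_le hΩ ⟨0, hn⟩
  refine ⟨C * C', fun φ => (hC φ).trans ?_⟩
  rw [mul_assoc]
  exact mul_le_mul_of_nonneg_left (hC' φ) hC0

/-! ### The energy space and reduction to an operator eigenvalue problem -/

variable (Ω) in
/-- The closure in `L²(Ω)` of the space of Laplacians of test functions. -/
def energySpace : Submodule ℝ (L2 Ω) :=
  (LinearMap.range (toL2 ∘ₗ lapₗ : 𝓓(Ω, ℝ) →ₗ[ℝ] L2 Ω)).topologicalClosure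

instance : CompleteSpace (energySpace Ω) :=
  (Submodule.isClosed_topologicalClosure _).completeSpace_coe

/-- The Laplacian of a test function, as an element of `energySpace Ω`. -/
def lapL2 : 𝓓(Ω, ℝ) →ₗ[ℝ] energySpace Ω :=
  (toL2 ∘ₗ lapₗ).codRestrict _ fun φ =>
    Submodule.le_topologicalClosure _ (LinearMap.mem_range_self _ φ)

lemma coe_lapL2 (φ : 𝓓(Ω, ℝ)) : (lapL2 φ : L2 Ω) = toL2 (lap φ) := by
  rw [← lapₗ_apply]
  rfl

lemma norm_lapL2 (φ : 𝓓(Ω, ℝ)) : ‖lapL2 φ‖ = ‖toL2 (lap φ)‖ := by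
  rw [← coe_lapL2]
  rfl

lemma denseRange_lapL2 : DenseRange (lapL2 : 𝓓(Ω, ℝ) → energySpace Ω) := by
  intro g
  rw [closure_subtype]
  refine closure_mono ?_ g.2
  rintro _ ⟨φ, rfl⟩
  exact ⟨lapL2 φ, ⟨φ, rfl⟩, rfl⟩

variable (Ω) in
/-- The inverse of the Laplacian: it sends `Δu` to `u` for `u ∈ H²₀(Ω)`. -/
def embed : energySpace Ω →L[ℝ] L2 Ω := toL2.extendOfNorm lapL2

variable (Ω) in
/-- The operator that sends `Δu` to `∂u/∂xᵢ` for `u ∈ H²₀(Ω)`. -/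
def gradOp (i : Fin n) : energySpace Ω →L[ℝ] L2 Ω := (toL2 ∘ₗ pdₗ i).extendOfNorm lapL2

variable (Ω) in
/-- The operator that sends `Δu` to `∂²u/∂xᵢ∂xⱼ` for `u ∈ H²₀(Ω)`. -/
def hessOp (i j : Fin n) : energySpace Ω →L[ℝ] L2 Ω :=
  (toL2 ∘ₗ pdₗ j ∘ₗ pdₗ i).extendOfNorm lapL2

variable (Ω) in
/-- The operator that sends `Δu` to `Δ((⟪v, x⟫ - c) u)` for `u ∈ H²₀(Ω)`. -/
def affOp (v : EuclideanSpace ℝ (Fin n)) (c : ℝ) : energySpace Ω →L[ℝ] energySpace Ω :=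
  (lapL2 ∘ₗ mulAff v c).extendOfNorm lapL2

variable (Ω) in
/-- The directional version of `gradOp`. -/
def dirOp (v : EuclideanSpace ℝ (Fin n)) : energySpace Ω →L[ℝ] L2 Ω := ∑ i, v i • gradOp Ω i

lemma dirOp_apply (v : EuclideanSpace ℝ (Fin n)) (g : energySpace Ω) :
    dirOp Ω v g = ∑ i, v i • gradOp Ω i g := by
  simp [dirOp]

lemma hessOp_lapL2 (i j : Fin n) (φ : 𝓓(Ω, ℝ)) :
    hessOp Ω i j (lapL2 φ) = toL2 (pd j (pd i φ)) :=
  LinearMap.extendOfNorm_eq denseRange_lapL2 ⟨1, fun φ => by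
    rw [one_mul, norm_lapL2]
    exact norm_pd_pd_le i j φ⟩ φ

lemma tendstoL2_iff {φ : ℕ → 𝓓(Ω, ℝ)} {u : L2 Ω} :
    TendstoL2 Ω φ u ↔ Tendsto (fun k => toL2 (φ k)) atTop (𝓝 u) := by
  rw [Lp.tendsto_Lp_iff_tendsto_eLpNorm', TendstoL2]
  refine iff_of_eq (congrArg (fun f => Tendsto f atTop (𝓝 0)) (funext fun k => ?_))
  refine eLpNorm_congr_ae ?_
  filter_upwards [coeFn_toL2 (φ k)] with x hx
  simp [hx]

lemma isWeakPartial_iff {i : Fin n} {u g : L2 Ω} :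
    IsWeakPartial Ω i u g ↔ ∀ φ, inner ℝ u (toL2 (pd i φ)) = -inner ℝ g (toL2 φ) := by
  simp only [IsWeakPartial, inner_toL2]

lemma solvesPlateEquation_iff {t : ℝ} {w : L2 Ω} :
    SolvesPlateEquation Ω t w ↔
      ∀ φ, inner ℝ w (toL2 (lap (lap φ))) = t * inner ℝ w (toL2 φ) := by
  simp only [SolvesPlateEquation, inner_toL2]

variable (Ω) in
/-- The operator whose eigenvalues are the reciprocals of the clamped plate eigenvalues. -/
def solOp : energySpace Ω →L[ℝ] energySpace Ω := (embed Ω).adjoint ∘L embed Ω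

lemma inner_solOp (g g' : energySpace Ω) :
    inner ℝ (solOp Ω g) g' = inner ℝ (embed Ω g) (embed Ω g') := by
  rw [solOp, ContinuousLinearMap.comp_apply, ContinuousLinearMap.adjoint_inner_left]

lemma isSymmetric_solOp : (solOp Ω : energySpace Ω →ₗ[ℝ] energySpace Ω).IsSymmetric := by
  intro g g'
  rw [real_inner_comm _ g]
  change inner ℝ (solOp Ω g) g' = inner ℝ (solOp Ω g') g
  rw [inner_solOp, inner_solOp, real_inner_comm]

section Bounded

variable (hΩ : Bornology.IsBounded (Ω : Set (EuclideanSpace ℝ (Fin n))))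

include hΩ in
lemma gradOp_lapL2 (i : Fin n) (φ : 𝓓(Ω, ℝ)) : gradOp Ω i (lapL2 φ) = toL2 (pd i φ) := by
  obtain ⟨C, hC⟩ := exists_norm_pd_le hΩ i
  exact LinearMap.extendOfNorm_eq denseRange_lapL2 ⟨C, fun φ => by
    rw [norm_lapL2]
    exact hC φ⟩ φ

include hΩ in
lemma dirOp_lapL2 (v : EuclideanSpace ℝ (Fin n)) (φ : 𝓓(Ω, ℝ)) :
    dirOp Ω v (lapL2 φ) = toL2 (dirDeriv v φ) := by
  simp [dirOp_apply, dirDeriv_apply, gradOp_lapL2 hΩ]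

include hΩ in
lemma affOp_lapL2 (v : EuclideanSpace ℝ (Fin n)) (c : ℝ) (φ : 𝓓(Ω, ℝ)) :
    affOp Ω v c (lapL2 φ) = lapL2 (mulAff v c φ) := by
  obtain ⟨C, hC⟩ := exists_norm_mulAff_le hΩ v c
  refine LinearMap.extendOfNorm_eq denseRange_lapL2 ⟨C + 2 * ‖dirOp Ω v‖, fun φ => ?_⟩ φ
  rw [LinearMap.comp_apply, norm_lapL2, lap_mulAff, map_add, map_smul, add_mul]
  refine (norm_add_le _ _).trans (add_le_add ?_ ?_)
  · rw [norm_lapL2]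
    exact hC _
  · rw [norm_smul, ← dirOp_lapL2 hΩ, mul_assoc]
    norm_num
    exact (dirOp Ω v).le_opNorm _

variable (hn : 1 ≤ n)

include hΩ hn

lemma embed_lapL2 (φ : 𝓓(Ω, ℝ)) : embed Ω (lapL2 φ) = toL2 φ := by
  obtain ⟨C, hC⟩ := exists_norm_le_lap hn hΩ
  exact LinearMap.extendOfNorm_eq denseRange_lapL2 ⟨C, fun φ => by
    rw [norm_lapL2]
    exact hC φ⟩ φ

/-- This is Δ(`embed` g) = g in the sense of distributions. Like the identities below, it is checked
on test functions and extended by density and continuity. -/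
lemma inner_embed_lap (g : energySpace Ω) (ψ : 𝓓(Ω, ℝ)) :
    inner ℝ (embed Ω g) (toL2 (lap ψ)) = inner ℝ (g : L2 Ω) (toL2 ψ) := by
  refine denseRange_lapL2.induction_on g (isClosed_eq (by fun_prop) (by fun_prop)) fun φ => ?_
  rw [embed_lapL2 hΩ hn, coe_lapL2, inner_lap]

lemma sum_norm_gradOp_sq (g : energySpace Ω) :
    ∑ i, ‖gradOp Ω i g‖ ^ 2 = -inner ℝ (embed Ω g) (g : L2 Ω) := by
  refine denseRange_lapL2.induction_on g (isClosed_eq (by fun_prop) (by fun_prop)) fun φ => ?_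
  simp only [embed_lapL2 hΩ hn, coe_lapL2, gradOp_lapL2 hΩ, sum_norm_pd_sq]

lemma norm_affOp_sq (v : EuclideanSpace ℝ (Fin n)) (c : ℝ) (g : energySpace Ω) :
    ‖affOp Ω v c g‖ ^ 2 = inner ℝ g (affOp Ω v c (affOp Ω v c g))
      + 4 * ‖dirOp Ω v g‖ ^ 2 - 2 * ‖v‖ ^ 2 * inner ℝ (embed Ω g) (g : L2 Ω) := by
  refine denseRange_lapL2.induction_on g (isClosed_eq (by fun_prop) (by fun_prop)) fun φ => ?_
  rw [affOp_lapL2 hΩ, affOp_lapL2 hΩ, norm_lapL2, dirOp_lapL2 hΩ, embed_lapL2 hΩ hn,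
    Submodule.coe_inner, coe_lapL2, coe_lapL2, norm_lap_mulAff_sq]

lemma norm_embed_sq (v : EuclideanSpace ℝ (Fin n)) (c : ℝ) (g : energySpace Ω) :
    ‖v‖ ^ 2 * ‖embed Ω g‖ ^ 2 = -2 * inner ℝ (dirOp Ω v g) (embed Ω (affOp Ω v c g)) := by
  refine denseRange_lapL2.induction_on g (isClosed_eq (by fun_prop) (by fun_prop)) fun φ => ?_
  rw [affOp_lapL2 hΩ, embed_lapL2 hΩ hn, embed_lapL2 hΩ hn, dirOp_lapL2 hΩ,
    norm_sq_eq_inner_dirDeriv]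

lemma inner_embed_affOp_affOp (v : EuclideanSpace ℝ (Fin n)) (c : ℝ) (g : energySpace Ω) :
    inner ℝ (embed Ω g) (embed Ω (affOp Ω v c (affOp Ω v c g)))
      = ‖embed Ω (affOp Ω v c g)‖ ^ 2 := by
  refine denseRange_lapL2.induction_on g (isClosed_eq (by fun_prop) (by fun_prop)) fun φ => ?_
  simp only [affOp_lapL2 hΩ, embed_lapL2 hΩ hn, inner_mulAff_mulAff]

lemma embed_affOp (v : EuclideanSpace ℝ (Fin n)) (c : ℝ) (g : energySpace Ω) :
    embed Ω (affOp Ω v c g)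
      = ∑ i, v i • embed Ω (affOp Ω (EuclideanSpace.single i 1) 0 g) - c • embed Ω g := by
  refine denseRange_lapL2.induction_on g (isClosed_eq (by fun_prop) (by fun_prop)) fun φ => ?_
  simp only [affOp_lapL2 hΩ, embed_lapL2 hΩ hn, ← map_smul (toL2 (Ω := Ω)), ← map_sum, ← map_sub]
  congr 1
  ext x
  have h : (∑ i, v i • mulAff (EuclideanSpace.single i 1) 0 φ - c • φ : 𝓓(Ω, ℝ)) x
      = ∑ i, v i * (x i * φ x) - c * φ x := by
    simp [mulAff_apply, EuclideanSpace.inner_single_left]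
  rw [h, mulAff_apply, PiLp.inner_apply, sub_mul, Finset.sum_mul]
  simp only [RCLike.inner_apply, conj_trivial]
  congr 1
  exact Finset.sum_congr rfl fun i _ => by ring

lemma embed_injective : Function.Injective (embed Ω) := by
  rw [injective_iff_map_eq_zero]
  intro g hg
  have h : ∀ g' : energySpace Ω, inner ℝ g g' = 0 := fun g' => by
    refine denseRange_lapL2.induction_on g' (isClosed_eq (by fun_prop) (by fun_prop)) fun φ => ?_
    rw [Submodule.coe_inner, coe_lapL2, ← inner_embed_lap hΩ hn, hg, inner_zero_left]
  exact inner_self_eq_zero.1 (h g)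

/-- If φₖ → u in H², then Δφₖ converges in L² to the trace of the weak Hessian, which is the
required g. Conversely, `gradOp` and `hessOp` supply the weak derivatives along any approximating
sequence. -/
lemma memH20_iff {u : L2 Ω} : MemH20 Ω u ↔ ∃ g, embed Ω g = u := by
  refine ⟨?_, ?_⟩
  · rintro ⟨g, h, -, -, φ, h0, -, h2⟩
    have h3 : Tendsto (fun k => (lapL2 (φ k) : L2 Ω)) atTop (𝓝 (∑ i, h i i)) := by
      simp only [coe_lapL2, lap, map_sum]
      exact tendsto_finsetSum _ fun i _ => tendstoL2_iff.1 (h2 i i)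
    have h4 : ∑ i, h i i ∈ energySpace Ω :=
      (Submodule.isClosed_topologicalClosure _).mem_of_tendsto h3
        (.of_forall fun k => (lapL2 (φ k)).2)
    refine ⟨⟨_, h4⟩, ?_⟩
    have h5 : Tendsto (fun k => lapL2 (φ k)) atTop (𝓝 ⟨_, h4⟩) := tendsto_subtype_rng.2 h3
    have h6 := ((embed Ω).continuous.tendsto _).comp h5
    refine tendsto_nhds_unique h6 ?_
    simpa only [Function.comp_def, embed_lapL2 hΩ hn] using tendstoL2_iff.1 h0
  · rintro ⟨g, rfl⟩
    obtain ⟨s, hs, hsg⟩ := mem_closure_iff_seq_limit.1 (denseRange_lapL2 g)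
    choose φ hφ using hs
    obtain rfl : s = fun k => lapL2 (φ k) := funext fun k => (hφ k).symm
    have key (A : energySpace Ω →L[ℝ] L2 Ω) :
        Tendsto (fun k => A (lapL2 (φ k))) atTop (𝓝 (A g)) := (A.continuous.tendsto _).comp hsg
    refine ⟨fun i => gradOp Ω i g, fun i j => hessOp Ω i j g, fun i => ?_, fun i j => ?_, φ,
      ?_, fun i => ?_, fun i j => ?_⟩
    · refine isWeakPartial_iff.2 fun ψ => ?_
      refine denseRange_lapL2.induction_on g (isClosed_eq (by fun_prop) (by fun_prop)) fun φ => ?_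
      dsimp only
      rw [gradOp_lapL2 hΩ, embed_lapL2 hΩ hn, inner_pd, neg_neg]
    · refine isWeakPartial_iff.2 fun ψ => ?_
      refine denseRange_lapL2.induction_on g (isClosed_eq (by fun_prop) (by fun_prop)) fun φ => ?_
      dsimp only
      rw [gradOp_lapL2 hΩ, hessOp_lapL2, inner_pd j, neg_neg]
    · simpa only [tendstoL2_iff, embed_lapL2 hΩ hn] using key (embed Ω)
    · simpa only [tendstoL2_iff, gradOp_lapL2 hΩ] using key (gradOp Ω i)
    · simpa only [tendstoL2_iff, hessOp_lapL2] using key (hessOp Ω i j)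

lemma solOp_injective : Function.Injective (solOp Ω) := by
  rw [injective_iff_map_eq_zero]
  intro g hg
  have h := inner_solOp g g
  rw [hg, inner_zero_left, eq_comm, inner_self_eq_zero] at h
  exact (injective_iff_map_eq_zero _).1 (embed_injective hΩ hn) g h

/-- Moving one Laplacian turns ⟪u, Δ²φ⟫ into ⟪g, Δφ⟫, while ⟪u, φ⟫ = ⟪`solOp` g, Δφ⟫; the functions
Δφ are dense in the energy space. -/
lemma solvesPlateEquation_embed_iff (t : ℝ) (g : energySpace Ω) :
    SolvesPlateEquation Ω t (embed Ω g) ↔ g = t • solOp Ω g := by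
  have h1 : SolvesPlateEquation Ω t (embed Ω g) ↔
      ∀ φ : 𝓓(Ω, ℝ), inner ℝ (g - t • solOp Ω g) (lapL2 φ) = 0 := by
    rw [solvesPlateEquation_iff]
    refine forall_congr' fun φ => ?_
    have h2 : inner ℝ (t • solOp Ω g) (lapL2 φ) = t * inner ℝ (solOp Ω g) (lapL2 φ) :=
      real_inner_smul_left (solOp Ω g) (lapL2 φ) t
    rw [inner_embed_lap hΩ hn, inner_sub_left, h2, inner_solOp,
      embed_lapL2 hΩ hn, Submodule.coe_inner, coe_lapL2, sub_eq_zero]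
  rw [h1, ← sub_eq_zero (b := t • solOp Ω g)]
  refine ⟨fun h => ?_, fun h φ => by rw [h, inner_zero_left]⟩
  exact denseRange_lapL2.eq_zero_of_inner_left ℝ h

lemma eigenspace_eq_map (t : ℝ) :
    eigenspace Ω t = (Module.End.eigenspace (solOp Ω : energySpace Ω →ₗ[ℝ] energySpace Ω) t⁻¹).map
      (embed Ω : energySpace Ω →ₗ[ℝ] L2 Ω) := by
  -- For t = 0, with 0⁻¹ = 0, both sides say g = 0 because `solOp` is injective.
  have key (g : energySpace Ω) : g = t • solOp Ω g ↔ solOp Ω g = t⁻¹ • g := by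
    rcases eq_or_ne t 0 with rfl | ht
    · rw [zero_smul, inv_zero, zero_smul,
        map_eq_zero_iff _ (solOp_injective hΩ hn)]
    · rw [eq_inv_smul_iff₀ ht, eq_comm]
  ext w
  rw [Submodule.mem_map]
  change MemH20 Ω w ∧ SolvesPlateEquation Ω t w ↔ _
  rw [memH20_iff hΩ hn]
  constructor
  · rintro ⟨⟨g, rfl⟩, h⟩
    exact ⟨g, Module.End.mem_eigenspace_iff.2
      ((key g).1 ((solvesPlateEquation_embed_iff hΩ hn t g).1 h)), rfl⟩
  · rintro ⟨g, hg, rfl⟩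
    exact ⟨⟨g, rfl⟩, (solvesPlateEquation_embed_iff hΩ hn t g).2
      ((key g).2 (Module.End.mem_eigenspace_iff.1 hg))⟩

lemma rank_eigenspace (t : ℝ) : Module.rank ℝ (eigenspace Ω t) = Module.rank ℝ
    (Module.End.eigenspace (solOp Ω : energySpace Ω →ₗ[ℝ] energySpace Ω) t⁻¹) := by
  rw [eigenspace_eq_map hΩ hn]
  exact (Submodule.equivMapOfInjective _ (embed_injective hΩ hn) _).rank_eq.symm

end Bounded

/-! ### Compactness of the solution operator -/

lemma sq_fderiv_testFunction_le (φ : 𝓓(Ω, ℝ)) (z v : EuclideanSpace ℝ (Fin n)) :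
    (fderiv ℝ φ z v) ^ 2 ≤ (∑ i, pd i φ z ^ 2) * ‖v‖ ^ 2 := by
  have h : fderiv ℝ φ z v = ∑ i, pd i φ z * v i := by
    conv_lhs => rw [← (EuclideanSpace.basisFun (Fin n) ℝ).sum_repr v]
    simp [pd_apply, mul_comm]
  rw [h, EuclideanSpace.norm_sq_eq]
  simpa using Finset.sum_mul_sq_le_sq_mul_sq Finset.univ (fun i => pd i φ z) v

lemma lintegral_sum_pd_sq (φ : 𝓓(Ω, ℝ)) :
    ∫⁻ x, ENNReal.ofReal (∑ i, pd i φ x ^ 2) = ENNReal.ofReal (∑ i, ‖toL2 (pd i φ)‖ ^ 2) := by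
  have hint (i : Fin n) : Integrable fun x => pd i φ x ^ 2 := by
    simpa only [sq] using integrable_testFunction_mul (pd i φ) (pd i φ)
  rw [← ofReal_integral_eq_lintegral_ofReal (integrable_finsetSum _ fun i _ => hint i)
    (.of_forall fun x => Finset.sum_nonneg fun i _ => sq_nonneg _),
    integral_finsetSum _ fun i _ => hint i]
  congr! 2 with i
  rw [← real_inner_self_eq_norm_sq, inner_toL2_toL2]
  simp only [sq]

lemma norm_le_of_lintegral_enorm_sq_le {u : L2 Ω} {B : ℝ} (hB : 0 ≤ B)
    (h : ∫⁻ x in (Ω : Set (EuclideanSpace ℝ (Fin n))), ‖u x‖ₑ ^ 2 ≤ ENNReal.ofReal (B ^ 2)) :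
    ‖u‖ ≤ B := by
  rw [Lp.norm_def]
  refine ENNReal.toReal_le_of_le_ofReal hB ?_
  have h1 := eLpNorm_nnreal_pow_eq_lintegral (p := 2) (f := u)
    (μ := volume.restrict (Ω : Set (EuclideanSpace ℝ (Fin n)))) two_ne_zero
  simp only [NNReal.coe_ofNat, ENNReal.rpow_ofNat, ENNReal.coe_ofNat] at h1
  rw [ENNReal.ofReal_pow hB, ← h1] at h
  exact (ENNReal.pow_le_pow_left_iff two_ne_zero).1 h

/-- W consists of the functions constant on each cube of a grid of side δ meeting Ω. -/
lemma exists_finiteDimensional_approx (hn : 1 ≤ n)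
    (hΩ : Bornology.IsBounded (Ω : Set (EuclideanSpace ℝ (Fin n)))) {ε : ℝ} (hε : 0 < ε) :
    ∃ W : Submodule ℝ (L2 Ω), FiniteDimensional ℝ W ∧
      ∀ φ : 𝓓(Ω, ℝ), ∃ w ∈ W, ‖toL2 φ - w‖ ≤ ε * ‖toL2 (lap φ)‖ := by
  obtain ⟨C, hC⟩ := exists_norm_le_lap hn hΩ
  -- The Poincaré constant of a cube is 2ⁿ(√n δ)², and |C| converts ‖∇φ‖² into ‖Δφ‖². The +1 below
  -- keeps the denominator positive.
  obtain ⟨δ, hδ, hδε⟩ : ∃ δ > 0, 2 ^ n * (√n * δ) ^ 2 * |C| ≤ ε ^ 2 := by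
    refine ⟨ε / √(2 ^ n * n * |C| + 1), by positivity, ?_⟩
    rw [mul_pow, div_pow, Real.sq_sqrt (by positivity), Real.sq_sqrt (by positivity),
      show 2 ^ n * (n * (ε ^ 2 / (2 ^ n * n * |C| + 1))) * |C|
        = ε ^ 2 * (2 ^ n * n * |C| / (2 ^ n * n * |C| + 1)) by ring]
    exact mul_le_of_le_one_right (by positivity) ((div_le_one (by positivity)).2 (by linarith))
  let S := (finite_floor_image hΩ hδ).toFinset
  have hS (x) (hx : x ∈ (Ω : Set (EuclideanSpace ℝ (Fin n)))) : (fun i => ⌊x i / δ⌋) ∈ S :=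
    (Set.Finite.mem_toFinset _).2 ⟨x, hx, rfl⟩
  have hcover : (Ω : Set (EuclideanSpace ℝ (Fin n))) ⊆ ⋃ k ∈ S, cube δ k := fun x hx =>
    Set.mem_biUnion (hS x hx) fun i => rfl
  have hvol (k : Fin n → ℤ) : volume.restrict (Ω : Set (EuclideanSpace ℝ (Fin n))) (cube δ k) ≠ ∞ :=
    ((Measure.restrict_le_self _).trans_lt (volume_cube_ne_top hδ k).lt_top).ne
  let ind (k : Fin n → ℤ) : L2 Ω :=
    indicatorConstLp 2 (measurableSet_cube δ k) (hvol k) (1 : ℝ)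
  refine ⟨Submodule.span ℝ (ind '' S), FiniteDimensional.span_of_finite ℝ (S.finite_toSet.image _),
    fun φ => ?_⟩
  choose c hc using fun k => exists_lintegral_sub_sq_le volume (convex_cube hδ k)
    (measurableSet_cube δ k) (volume_cube_ne_top hδ k)
    (fun x hx y hy => norm_sub_le_of_mem_cube hδ hx hy)
    (φ.contDiff.of_le (WithTop.coe_le_coe.2 (le_top (a := (1 : ℕ∞)))))
    (F := fun x => ∑ i, pd i φ x ^ 2) (by fun_prop) (sq_fderiv_testFunction_le φ)
  refine ⟨∑ k ∈ S, c k • ind k, Submodule.sum_mem _ fun k hk =>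
    Submodule.smul_mem _ _ (Submodule.subset_span ⟨k, hk, rfl⟩), ?_⟩
  refine norm_le_of_lintegral_enorm_sq_le (by positivity) ?_
  have hdisj : (S : Set (Fin n → ℤ)).PairwiseDisjoint (cube δ) := fun k _ l _ hkl =>
    Set.disjoint_left.2 fun x hx hy => hkl (funext fun i => (hx i).symm.trans (hy i))
  have hw : ∀ᵐ x ∂volume.restrict (Ω : Set (EuclideanSpace ℝ (Fin n))),
      (toL2 φ - ∑ k ∈ S, c k • ind k : L2 Ω) x = φ x - c fun i => ⌊x i / δ⌋ := by
    have h1 : ∀ᵐ x ∂volume.restrict (Ω : Set (EuclideanSpace ℝ (Fin n))), ∀ k : Fin n → ℤ,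
        (c k • ind k : L2 Ω) x = c k * (cube δ k).indicator (fun _ => (1 : ℝ)) x := by
      refine ae_all_iff.2 fun k => ?_
      filter_upwards [Lp.coeFn_smul (c k) (ind k),
        indicatorConstLp_coeFn (p := 2) (hs := measurableSet_cube δ k) (hμs := hvol k)
          (c := (1 : ℝ))] with x h1 h2
      rw [h1, Pi.smul_apply, h2, smul_eq_mul]
    filter_upwards [h1, coeFn_toL2 φ, Lp.coeFn_sub (toL2 φ) (∑ k ∈ S, c k • ind k),
      Lp.coeFn_finsetSum S (fun k => c k • ind k), ae_restrict_mem Ω.isOpen.measurableSet]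
      with x h1 h2 h3 h4 hx
    rw [h3, Pi.sub_apply, h2, h4, Finset.sum_apply, Finset.sum_eq_single fun i => ⌊x i / δ⌋]
    · rw [h1, Set.indicator_of_mem (show x ∈ cube δ _ from fun i => rfl), mul_one]
    · intro k _ hk
      rw [h1, Set.indicator_of_notMem fun h => hk (funext fun i => (h i).symm), mul_zero]
    · exact fun h => absurd (hS x hx) h
  calc ∫⁻ x in (Ω : Set (EuclideanSpace ℝ (Fin n))),
        ‖(toL2 φ - ∑ k ∈ S, c k • ind k : L2 Ω) x‖ₑ ^ 2
      = ∫⁻ x in (Ω : Set (EuclideanSpace ℝ (Fin n))), ‖φ x - c fun i => ⌊x i / δ⌋‖ₑ ^ 2 :=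
        lintegral_congr_ae (hw.mono fun x hx => by simp only [hx])
    -- Cubes crossing ∂Ω are used whole: φ is defined on all of ℝⁿ and vanishes off Ω, so no
    -- boundary regularity is needed.
    _ ≤ ∫⁻ x in ⋃ k ∈ S, cube δ k, ‖φ x - c fun i => ⌊x i / δ⌋‖ₑ ^ 2 :=
        lintegral_mono_set hcover
    _ = ∑ k ∈ S, ∫⁻ x in cube δ k, ‖φ x - c fun i => ⌊x i / δ⌋‖ₑ ^ 2 :=
        lintegral_biUnion_finset hdisj (fun k _ => measurableSet_cube δ k) _
    _ = ∑ k ∈ S, ∫⁻ x in cube δ k, ‖φ x - c k‖ₑ ^ 2 :=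
        Finset.sum_congr rfl fun k _ => setLIntegral_congr_fun (measurableSet_cube δ k)
          fun x hx => by rw [show (fun i => ⌊x i / δ⌋) = k from funext hx]
    _ ≤ ∑ k ∈ S, 2 ^ n * ENNReal.ofReal ((√n * δ) ^ 2) *
          ∫⁻ x in cube δ k, ENNReal.ofReal (∑ i, pd i φ x ^ 2) :=
        Finset.sum_le_sum fun k _ => by simpa using hc k
    _ = 2 ^ n * ENNReal.ofReal ((√n * δ) ^ 2) *
          ∫⁻ x in ⋃ k ∈ S, cube δ k, ENNReal.ofReal (∑ i, pd i φ x ^ 2) := by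
        rw [lintegral_biUnion_finset hdisj fun k _ => measurableSet_cube δ k, Finset.mul_sum]
    _ ≤ 2 ^ n * ENNReal.ofReal ((√n * δ) ^ 2) * ENNReal.ofReal (∑ i, ‖toL2 (pd i φ)‖ ^ 2) := by
        rw [← lintegral_sum_pd_sq]
        gcongr
        exact Measure.restrict_le_self
    _ = ENNReal.ofReal (2 ^ n * (√n * δ) ^ 2 * ∑ i, ‖toL2 (pd i φ)‖ ^ 2) := by
        rw [ENNReal.ofReal_mul (by positivity), ENNReal.ofReal_mul (by positivity),
          ENNReal.ofReal_pow zero_le_two, ENNReal.ofReal_ofNat]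
    _ ≤ _ := by
        refine ENNReal.ofReal_le_ofReal ?_
        have h1 : ∑ i, ‖toL2 (pd i φ)‖ ^ 2 ≤ |C| * ‖toL2 (lap φ)‖ ^ 2 := by
          rw [sum_norm_pd_sq]
          refine (neg_le_abs _).trans ((abs_real_inner_le_norm _ _).trans ?_)
          rw [sq, ← mul_assoc]
          gcongr
          exact (hC φ).trans (by gcongr; exact le_abs_self C)
        rw [mul_pow ε]
        refine (mul_le_mul_of_nonneg_left h1 (by positivity)).trans ?_
        rw [← mul_assoc]
        exact mul_le_mul_of_nonneg_right hδε (sq_nonneg _)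

lemma isCompactOperator_embed (hn : 1 ≤ n)
    (hΩ : Bornology.IsBounded (Ω : Set (EuclideanSpace ℝ (Fin n)))) :
    IsCompactOperator (embed Ω) := by
  refine isCompactOperator_of_forall_exists_norm_sub_le denseRange_lapL2 _ fun ε hε => ?_
  simp only [embed_lapL2 hΩ hn, norm_lapL2]
  exact exists_finiteDimensional_approx hn hΩ hε

lemma isCompactOperator_solOp (hn : 1 ≤ n)
    (hΩ : Bornology.IsBounded (Ω : Set (EuclideanSpace ℝ (Fin n)))) :
    IsCompactOperator (solOp Ω) :=
  (isCompactOperator_embed hn hΩ).clm_comp (embed Ω).adjoint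

lemma inner_solOp_self_pos (hn : 1 ≤ n)
    (hΩ : Bornology.IsBounded (Ω : Set (EuclideanSpace ℝ (Fin n)))) (g : energySpace Ω)
    (hg : g ≠ 0) : 0 < inner ℝ (solOp Ω g) g := by
  rw [inner_solOp, real_inner_self_eq_norm_sq]
  have := norm_pos_iff.2 ((map_ne_zero_iff _ (embed_injective hΩ hn)).2 hg)
  positivity

/-! ### Infinite dimension and existence of the eigenvalue list -/

lemma exists_orthogonal_testFunctions (hn : 1 ≤ n)
    (hΩ : (Ω : Set (EuclideanSpace ℝ (Fin n))).Nonempty) :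
    ∃ φ : ℕ → 𝓓(Ω, ℝ), (∀ k, toL2 (φ k) ≠ 0) ∧
      Pairwise fun j k => inner ℝ (toL2 (φ j)) (toL2 (φ k)) = 0 := by
  have : Nonempty (Fin n) := ⟨⟨0, hn⟩⟩
  have : Infinite Ω := (infinite_of_mem_nhds hΩ.some (Ω.isOpen.mem_nhds hΩ.some_mem)).to_subtype
  obtain ⟨U, hU, hUo, hUd⟩ := exists_seq_infinite_isOpen_pairwise_disjoint Ω
  choose x hx using fun k => (hU k).nonempty
  have hV (k : ℕ) : IsOpen ((↑) '' U k : Set (EuclideanSpace ℝ (Fin n))) :=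
    Ω.isOpen.isOpenMap_subtype_val _ (hUo k)
  have hf (k : ℕ) := exists_contDiff_tsupport_subset (n := ⊤)
    ((hV k).mem_nhds (Set.mem_image_of_mem _ (hx k)))
  choose f hfs hfc hfd hf0 hf1 using hf
  have hfΩ (k : ℕ) : tsupport (f k) ⊆ Ω := (hfs k).trans (Subtype.coe_image_subset _ _)
  let φ (k : ℕ) : 𝓓(Ω, ℝ) := ⟨f k, hfd k, hfc k, hfΩ k⟩
  refine ⟨φ, fun k h => ?_, fun j k hjk => ?_⟩
  · have h0 : inner ℝ (toL2 (φ k)) (toL2 (φ k)) = 0 := by rw [h, inner_zero_left]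
    rw [inner_toL2_toL2] at h0
    refine (((φ k).continuous.mul
      (φ k).continuous).integral_pos_of_hasCompactSupport_nonneg_nonzero (μ := volume)
      (hfc k).mul_right (fun x => mul_self_nonneg _) (x := (x k).1) ?_).ne' h0
    change f k (x k) * f k (x k) ≠ 0
    simp [hf1]
  · change inner ℝ (toL2 (φ j)) (toL2 (φ k)) = 0
    rw [inner_toL2_toL2]
    refine integral_eq_zero_of_ae (.of_forall fun y => ?_)
    by_contra hy
    obtain ⟨h1, h2⟩ := mul_ne_zero_iff.1 hy
    obtain ⟨a, ha, rfl⟩ := hfs j (subset_tsupport _ h1)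
    obtain ⟨b, hb, hab⟩ := hfs k (subset_tsupport _ h2)
    exact Set.disjoint_left.1 (hUd hjk) ha (Subtype.ext hab ▸ hb)

lemma not_finiteDimensional_energySpace (hn : 1 ≤ n)
    (hb : Bornology.IsBounded (Ω : Set (EuclideanSpace ℝ (Fin n))))
    (hΩ : (Ω : Set (EuclideanSpace ℝ (Fin n))).Nonempty) :
    ¬ FiniteDimensional ℝ (energySpace Ω) := by
  intro hfin
  obtain ⟨φ, hφ, hφo⟩ := exists_orthogonal_testFunctions hn hΩ
  have h1 : LinearIndependent ℝ fun k => toL2 (φ k) :=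
    linearIndependent_of_ne_zero_of_inner_eq_zero hφ hφo
  have h2 : LinearIndependent ℝ fun k => lapL2 (φ k) := by
    refine LinearIndependent.of_comp (embed Ω : energySpace Ω →ₗ[ℝ] L2 Ω) ?_
    convert h1 using 2 with k
    exact embed_lapL2 hb hn _
  have := h2.finite
  exact not_finite ℕ

theorem exists_isEigenvalueList (hn : 1 ≤ n)
    (hb : Bornology.IsBounded (Ω : Set (EuclideanSpace ℝ (Fin n))))
    (hΩ : (Ω : Set (EuclideanSpace ℝ (Fin n))).Nonempty) :
    ∃ Γ : ℕ → ℝ, IsEigenvalueList Ω Γ := by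
  obtain ⟨Γ, hm, hc⟩ := exists_monotone_eigenvalue_list (inner_solOp_self_pos hn hb)
    isSymmetric_solOp (isCompactOperator_solOp hn hb) (not_finiteDimensional_energySpace hn hb hΩ)
  exact ⟨Γ, hm, fun t => (hc t).trans (rank_eigenspace hb hn t).symm⟩

/-! ### The eigenvalue inequality -/

/-- The coordinate matrix of b is orthogonal, so its columns are orthonormal too. Applied to the
gradient, it makes the sum of squared directional derivatives independent of the basis. -/
lemma sum_norm_sum_smul_sq {H : Type*} [NormedAddCommGroup H] [InnerProductSpace ℝ H]
    (b : OrthonormalBasis (Fin n) ℝ (EuclideanSpace ℝ (Fin n))) (w : Fin n → H) :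
    ∑ k, ‖∑ i, b k i • w i‖ ^ 2 = ∑ i, ‖w i‖ ^ 2 := by
  have hb (i j : Fin n) : ∑ k, b k i * b k j = if i = j then 1 else 0 := by
    have h := b.sum_inner_mul_inner (EuclideanSpace.single i (1 : ℝ)) (EuclideanSpace.single j 1)
    simpa [EuclideanSpace.inner_single_left, EuclideanSpace.inner_single_right,
      PiLp.single_apply, eq_comm] using h
  have hk (k : Fin n) : ‖∑ i, b k i • w i‖ ^ 2
      = ∑ i, ∑ j, b k i * b k j * inner ℝ (w i) (w j) := by
    rw [← real_inner_self_eq_norm_sq, sum_inner]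
    refine Finset.sum_congr rfl fun i _ => ?_
    rw [inner_sum]
    refine Finset.sum_congr rfl fun j _ => ?_
    rw [real_inner_smul_left, real_inner_smul_right, mul_assoc]
  simp only [hk]
  rw [Finset.sum_comm]
  refine Finset.sum_congr rfl fun i _ => ?_
  rw [Finset.sum_comm]
  simp [← Finset.sum_mul, hb]

lemma neg_inner_embed_le {g : energySpace Ω} {γ : ℝ} (hg : ‖g‖ = 1)
    (hT : solOp Ω g = γ⁻¹ • g) : -inner ℝ (embed Ω g) (g : L2 Ω) ≤ 1 / √γ := by
  have h1 : ‖embed Ω g‖ ^ 2 = γ⁻¹ := by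
    rw [← real_inner_self_eq_norm_sq, ← inner_solOp, hT, real_inner_smul_left g g γ⁻¹,
      real_inner_self_eq_norm_sq, hg]
    norm_num
  have h2 : ‖embed Ω g‖ = 1 / √γ := by
    rw [← Real.sqrt_sq (norm_nonneg _), h1, Real.sqrt_inv, one_div]
  refine (neg_le_abs _).trans ((abs_real_inner_le_norm _ _).trans ?_)
  rw [h2, show ‖(g : L2 Ω)‖ = 1 from hg, mul_one]

section Bounded

variable (hn : 1 ≤ n) (hΩ : Bornology.IsBounded (Ω : Set (EuclideanSpace ℝ (Fin n))))

include hn hΩ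

lemma sqrt_le_sqrt_add {v : EuclideanSpace ℝ (Fin n)} (hv : ‖v‖ = 1) (c : ℝ)
    {g : energySpace Ω} {γ γ' : ℝ} (hγ : 0 < γ) (hγγ' : γ ≤ γ') (hg : ‖g‖ = 1)
    (hT : solOp Ω g = γ⁻¹ • g)
    (h : γ' * ‖embed Ω (affOp Ω v c g)‖ ^ 2 ≤ ‖affOp Ω v c g‖ ^ 2) :
    √γ' ≤ √γ + 4 * γ * ‖dirOp Ω v g‖ ^ 2 := by
  have hK (g' : energySpace Ω) : inner ℝ g g' = γ * inner ℝ (embed Ω g) (embed Ω g') := by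
    rw [← inner_solOp, hT, real_inner_smul_left g g' γ⁻¹, mul_inv_cancel_left₀ hγ.ne']
  have h1 := norm_affOp_sq hΩ hn v c g
  rw [hK, inner_embed_affOp_affOp hΩ hn, hv] at h1
  have h2 := norm_embed_sq hΩ hn v c g
  have h3 : γ * ‖embed Ω g‖ ^ 2 = 1 := by
    rw [← real_inner_self_eq_norm_sq, ← hK, real_inner_self_eq_norm_sq, hg, one_pow]
  have h4 := neg_inner_embed_le hg hT
  have h5 := abs_real_inner_le_norm (dirOp Ω v g) (embed Ω (affOp Ω v c g))
  have h6 := neg_abs_le (inner ℝ (dirOp Ω v g) (embed Ω (affOp Ω v c g)))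
  rw [hv, one_pow, one_mul] at h2
  set s := ‖dirOp Ω v g‖
  set q := ‖embed Ω (affOp Ω v c g)‖
  set S := inner ℝ (embed Ω g) (g : L2 Ω)
  have hs : 0 ≤ s := norm_nonneg _
  have hq : 0 ≤ q := norm_nonneg _
  have hr : 0 < √γ := Real.sqrt_pos.2 hγ
  have hrr : √γ ^ 2 = γ := Real.sq_sqrt hγ.le
  -- Cauchy–Schwarz in `h2`, multiplied by γ, since ‖u‖² = 1/γ.
  have h7 : 1 ≤ 2 * γ * (s * q) := by nlinarith
  have h8 : 1 ≤ 4 * γ ^ 2 * s ^ 2 * q ^ 2 := by nlinarith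
  have h9 : (γ' - γ) * q ^ 2 ≤ 4 * s ^ 2 + 2 * (1 / √γ) := by nlinarith
  have h10 : γ' - γ ≤ 4 * γ ^ 2 * s ^ 2 * (4 * s ^ 2 + 2 * (1 / √γ)) :=
    calc γ' - γ ≤ (γ' - γ) * (4 * γ ^ 2 * s ^ 2 * q ^ 2) :=
          le_mul_of_one_le_right (sub_nonneg.2 hγγ') h8
      _ = 4 * γ ^ 2 * s ^ 2 * ((γ' - γ) * q ^ 2) := by ring
      _ ≤ _ := by gcongr
  -- The bound in `h10` is exactly (√γ + 4γs²)² - γ.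
  refine Real.sqrt_le_iff.2 ⟨by positivity, ?_⟩
  have h11 : γ ^ 2 * (1 / √γ) = γ * √γ := by
    field_simp
    rw [hrr]
  nlinarith

theorem sum_sqrt_div_le {Γ : ℕ → ℝ} (hΓ : IsEigenvalueList Ω Γ) :
    0 < Γ 0 ∧ (∑ k ∈ Finset.Icc 1 n, √(Γ k)) / √(Γ 0) ≤ (n : ℝ) + 4 := by
  have hpos := inner_solOp_self_pos hn hΩ
  have hc := isCompactOperator_solOp hn hΩ
  obtain ⟨e, he, heT, hspan⟩ := exists_orthonormal_of_eigenvalue_list hpos isSymmetric_solOp hc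
    fun t => (hΓ.multiplicity t).trans (rank_eigenspace hΩ hn t)
  have hΓpos (j : ℕ) : 0 < Γ j := by
    have h := hpos (e j) (he.ne_zero j)
    rw [heT, real_inner_smul_left (e j) (e j) (Γ j)⁻¹, real_inner_self_eq_norm_sq, he.1] at h
    simpa using h
  have hK (j : ℕ) (g : energySpace Ω) :
      inner ℝ (e j) g = Γ j * inner ℝ (embed Ω (e j)) (embed Ω g) := by
    rw [← inner_solOp, heT, real_inner_smul_left (e j) g (Γ j)⁻¹,
      mul_inv_cancel_left₀ (hΓpos j).ne']
  let x (i : Fin n) : L2 Ω := embed Ω (affOp Ω (EuclideanSpace.single i 1) 0 (e 0))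
  -- With uₖ = `embed` (e k), the vector m j has the entries ⟪uⱼ₊₁, xₗu₀⟫. Gram–Schmidt makes b i
  -- orthogonal to m j for j < i, that is, ⟪b i, x⟫u₀ orthogonal to u₁, …, uᵢ.
  let m (j : Fin n) : EuclideanSpace ℝ (Fin n) :=
    WithLp.toLp 2 fun i => inner ℝ (embed Ω (e (j + 1))) (x i)
  let b := InnerProductSpace.gramSchmidtOrthonormalBasis (𝕜 := ℝ) (by simp) m
  have hbm {i j : Fin n} (hji : j < i) : ∑ l, b i l * inner ℝ (embed Ω (e (j + 1))) (x l) = 0 := by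
    have h := InnerProductSpace.gramSchmidtOrthonormalBasis_inv_triangular (𝕜 := ℝ)
      (by simp) m hji
    rw [PiLp.inner_apply] at h
    simpa [m, mul_comm] using h
  -- As ‖u₀‖² = 1/Γ₀, this is the mean of ⟪b i, x⟫ with weight u₀², which gives orthogonality to u₀.
  let c (i : Fin n) : ℝ := Γ 0 * ∑ l, b i l * inner ℝ (embed Ω (e 0)) (x l)
  -- The i + 1 conditions against e 0, …, e i make the trial function admissible for Γ (i + 1). By
  -- `hK`, energy and L² orthogonality to an eigenvector coincide.
  have horth (i : Fin n) (k : ℕ) (hk : k < i + 1) :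
      inner ℝ (e k) (affOp Ω (b i) (c i) (e 0)) = 0 := by
    have h0 : inner ℝ (embed Ω (e k)) (embed Ω (affOp Ω (b i) (c i) (e 0)))
        = ∑ l, b i l * inner ℝ (embed Ω (e k)) (x l)
          - c i * inner ℝ (embed Ω (e k)) (embed Ω (e 0)) := by
      rw [embed_affOp hΩ hn]
      simp only [inner_sub_right, inner_sum, inner_smul_right, x]
    have h1 := hK k (e 0)
    rw [hK, h0]
    rcases k with _ | k
    · rw [real_inner_self_eq_norm_sq (e 0), he.1] at h1
      have h2 : c i * inner ℝ (embed Ω (e 0)) (embed Ω (e 0))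
          = ∑ l, b i l * inner ℝ (embed Ω (e 0)) (x l) := by
        rw [mul_right_comm, ← h1]
        simp
      rw [h2, sub_self, mul_zero]
    · rw [he.2 k.succ_ne_zero, eq_comm, mul_eq_zero, or_iff_right (hΓpos _).ne'] at h1
      rw [h1, mul_zero, sub_zero, hbm (j := ⟨k, by omega⟩) (Fin.lt_def.2 (by simpa using hk)),
        mul_zero]
  have hle (i : Fin n) :
      √(Γ (i + 1)) ≤ √(Γ 0) + 4 * Γ 0 * ‖dirOp Ω (b i) (e 0)‖ ^ 2 := by
    refine sqrt_le_sqrt_add hn hΩ (b.norm_eq_one i) (c i) (hΓpos 0) (hΓ.monotone (Nat.zero_le _))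
      (he.1 0) (heT 0) ?_
    have h := inner_apply_self_le_of_orthogonal hpos hΓ.monotone he heT isSymmetric_solOp hspan
      (horth i)
    rwa [inner_solOp, real_inner_self_eq_norm_sq, ← div_eq_inv_mul, le_div_iff₀' (hΓpos _)] at h
  have hsum : ∑ i, ‖dirOp Ω (b i) (e 0)‖ ^ 2 ≤ 1 / √(Γ 0) := by
    simp only [dirOp_apply]
    rw [sum_norm_sum_smul_sq, sum_norm_gradOp_sq hΩ hn]
    exact neg_inner_embed_le (he.1 0) (heT 0)
  have hr : 0 < √(Γ 0) := Real.sqrt_pos.2 (hΓpos 0)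
  refine ⟨hΓpos 0, (div_le_iff₀ hr).2 ?_⟩
  rw [← Finset.Ico_succ_right_eq_Icc, Finset.sum_Ico_eq_sum_range, Finset.sum_range]
  calc ∑ i : Fin n, √(Γ (1 + i))
      ≤ ∑ i : Fin n, (√(Γ 0) + 4 * Γ 0 * ‖dirOp Ω (b i) (e 0)‖ ^ 2) :=
        Finset.sum_le_sum fun i _ => by rw [add_comm]; exact hle i
    _ = n * √(Γ 0) + 4 * Γ 0 * ∑ i, ‖dirOp Ω (b i) (e 0)‖ ^ 2 := by
        rw [Finset.sum_add_distrib, Finset.mul_sum]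
        simp
    _ ≤ n * √(Γ 0) + 4 * Γ 0 * (1 / √(Γ 0)) := by
        have := (hΓpos 0).le
        gcongr
    _ = _ := by
        have := Real.sq_sqrt (hΓpos 0).le
        field_simp
        nlinarith

end Bounded

end Plate

end ClampedPlate

end

theorem mainTheorem6 (n : ℕ) (hn : 1 ≤ n)
    (Ω : TopologicalSpace.Opens (EuclideanSpace ℝ (Fin n)))
    (hconn : IsConnected (Ω : Set (EuclideanSpace ℝ (Fin n))))
    (hbdd : Bornology.IsBounded (Ω : Set (EuclideanSpace ℝ (Fin n)))) :
    (∃ Γ : ℕ → ℝ, ClampedPlate.IsEigenvalueList Ω Γ) ∧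
    ∀ Γ : ℕ → ℝ, ClampedPlate.IsEigenvalueList Ω Γ →
      0 < Γ 0 ∧
      (∑ k ∈ Finset.Icc 1 n, √(Γ k)) / √(Γ 0) ≤ (n : ℝ) + 4 :=
  ⟨ClampedPlate.exists_isEigenvalueList hn hbdd hconn.nonempty,
    fun _ hΓ => ClampedPlate.sum_sqrt_div_le hn hbdd hΓ⟩
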